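/- Let $\mathcal A$ be a von Neumann algebra with a finite, faithful, normal trace $\tau$, acting on its standard Hilbert space $\mathcal H=L^2(\mathcal A,\tau)$, the completion of $\mathcal A$ for $\langle a,b\rangle=\tau(b^*a)$; write $\|a\|_2=\tau(a^*a)^{1/2}$ and regard $\mathcal A$ as a dense subspace of $\mathcal H$. Let $I\subset\mathbb R$ be an interval with $0\in I$. For each $t\in I$ let $\mathcal B_t\subset\mathcal A$ be a von Neumann subalgebra (with the same unit) and let $E_t:\mathcal A\to\mathcal B_t$ be the $\tau$-preserving conditional expectation. Suppose that for all $a\in\mathcal A$ and $\xi\in\mathcal H$ the curve $I\ni t\mapsto E_t(a)\xi\in\mathcal H$ is continuously differentiable (one-sidedly at endpoints of $I$ that belong to $I$), and let $dE_t(a)\in\mathcal A$ be the operator $dE_t(a)\xi=\frac{d}{dt}E_t(a)\xi$. Suppose also that for every closed bounded interval $J\subset I$ there is a constant $C_J>0$, depending only on $J$, such that $$\int_J\|dE_t(a)\|_2^2\,dt\le C_J\|a\|_2^2\qquad\text{for all } a\in\mathcal A .$$ A weak solution of the transport equation $\dot\alpha(t)=[dE_t,E_t](\alpha(t))=dE_t(E_t(\alpha(t)))-E_t(dE_t(\alpha(t)))$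 is a map $\alpha:I\to\mathcal A$ such that, for every $\xi\in\mathcal H$, the function $t\mapsto\langle\alpha(t),\xi\rangle$ is differentiable on $I$ with derivative $\langle[dE_t,E_t](\alpha(t)),\xi\rangle$. Then for every $a\in\mathcal A$ the transport equation has a unique weak solution $\alpha$ on $I$ with $\alpha(0)=a$, so that the propagators $G_t:\mathcal A\to\mathcal A$, $G_t(a)=\alpha(t)$, are well defined; and for each $t\in I$ the restriction $\theta_t:=G_t|_{\mathcal B_0}$ is a multiplicative $*$-isomorphism of $\mathcal B_0$ onto $\mathcal B_t$. In particular all the algebras $\mathcal B_t$ are $*$-isomorphic to $\mathcal B_0$. -/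

import Mathlib

open Set Filter Topology MeasureTheory
open scoped ComplexOrder

noncomputable section

namespace VNPath

universe u

variable {H : Type u} [NormedAddCommGroup H] [InnerProductSpace ℂ H] [CompleteSpace H]

/-- The `*`-algebra of elements of the von Neumann algebra `A`, as a type. -/
abbrev Elem (A : VonNeumannAlgebra H) : Type u := A.toStarSubalgebra

/-- An element of `A`, as a bounded operator on `H`. -/
abbrev op {A : VonNeumannAlgebra H} (a : Elem A) : H →L[ℂ] H := (a : H →L[ℂ] H)

/-- `τ` is a finite, faithful, normal, positive trace on the von Neumann algebra `A`. Normality is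
preservation of suprema of upwards directed families of positive elements. -/
structure IsFaithfulNormalTrace (A : VonNeumannAlgebra H) (τ : Elem A →ₗ[ℂ] ℂ) : Prop where
  nonneg : ∀ a : Elem A, 0 ≤ τ (star a * a)
  trace : ∀ a b : Elem A, τ (a * b) = τ (b * a)
  faithful : ∀ a : Elem A, τ (star a * a) = 0 → a = 0
  normal : ∀ (S : Set (Elem A)) (a : Elem A), S.Nonempty → (∀ x ∈ S, (op x).IsPositive) →
    (∀ x ∈ S, ∀ y ∈ S, ∃ z ∈ S, op x ≤ op z ∧ op y ≤ op z) →
    (∀ x ∈ S, op x ≤ op a) → (∀ b : Elem A, (∀ x ∈ S, op x ≤ op b) → op a ≤ op b) →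
    IsLUB ((fun x => (τ x).re) '' S) (τ a).re

/-- The Hilbert space `H` on which `A` acts is the standard space `L²(A, τ)`, the vector `Ω`
being the class of `1 ∈ A`: the map `a ↦ a Ω` identifies `A` with a dense subspace of `H`, on which
the inner product is `⟨a, b⟩ = τ (b* a)` (linear in `a`), and `A` acts by left multiplication. -/
structure IsStandardSpace (A : VonNeumannAlgebra H) (τ : Elem A →ₗ[ℂ] ℂ) (Ω : H) : Prop where
  inner_eq : ∀ a b : Elem A, inner ℂ (op b Ω) (op a Ω) = τ (star b * a)
  dense : DenseRange (fun a : Elem A => op a Ω)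

/-- `E : A → A` is a `τ`-preserving conditional expectation onto the von Neumann subalgebra `B`. -/
structure IsTraceCondExp (A B : VonNeumannAlgebra H) (τ : Elem A →ₗ[ℂ] ℂ)
    (E : Elem A →ₗ[ℂ] Elem A) : Prop where
  mem : ∀ a : Elem A, op (E a) ∈ B
  fixed : ∀ b : Elem A, op b ∈ B → E b = b
  positive : ∀ a : Elem A, (op a).IsPositive → (op (E a)).IsPositive
  bimodule : ∀ a b c : Elem A, op b ∈ B → op c ∈ B → E (b * a * c) = b * E a * c
  trace_eq : ∀ a : Elem A, τ (E a) = τ a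

/-- Smoothness of the path `t ↦ E t`, `t ∈ I`: for every `a ∈ A` and `ξ ∈ H`, the curve
`t ↦ E t (a) ξ` is continuously differentiable on `I` (one-sidedly at endpoints belonging to `I`). -/
def IsSmoothPath {A : VonNeumannAlgebra H} (I : Set ℝ) (E : ℝ → Elem A →ₗ[ℂ] Elem A) : Prop :=
  ∀ (a : Elem A) (ξ : H), ContDiffOn ℝ 1 (fun t => op (E t a) ξ) I

open Classical in
/-- The derivative `dE t (a) ∈ A`: the element of `A` with `dE t (a) ξ = d/dt (E t (a) ξ)` for all
`ξ ∈ H`. For a smooth path it exists, see `dE_apply`. -/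
def dE {A : VonNeumannAlgebra H} (I : Set ℝ) (E : ℝ → Elem A →ₗ[ℂ] Elem A) (t : ℝ)
    (a : Elem A) : Elem A :=
  if h : ∃ d : Elem A, ∀ ξ : H, op d ξ = derivWithin (fun s => op (E s a) ξ) I t
  then h.choose else 0

theorem exists_dE {A : VonNeumannAlgebra H} {I : Set ℝ} {E : ℝ → Elem A →ₗ[ℂ] Elem A}
    (hE : IsSmoothPath I E) {t : ℝ} (ht : t ∈ I) (a : Elem A) :
    ∃ d : Elem A, ∀ ξ : H, op d ξ = derivWithin (fun s => op (E s a) ξ) I t := by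
  by_cases hacc : AccPt t (𝓟 I)
  · have hne : (𝓝[I \ {t}] t).NeBot := accPt_principal_iff_nhdsWithin.mp hacc
    let g : ℝ → (H →L[ℂ] H) := fun s => (((s - t)⁻¹ : ℝ) : ℂ) • (op (E s a) - op (E t a))
    have hlim : ∀ ξ : H, Tendsto (fun s => g s ξ) (𝓝[I \ {t}] t)
        (𝓝 (derivWithin (fun s => op (E s a) ξ) I t)) := by
      intro ξ
      have h1 := (((hE a ξ).differentiableOn (by norm_num)) t ht).hasDerivWithinAt
      rw [hasDerivWithinAt_iff_tendsto_slope] at h1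
      refine h1.congr (fun s => ?_)
      simp only [slope_def_module, g, op]
      rw [smul_apply, Complex.coe_smul, sub_apply]
    let d := continuousLinearMapOfTendsto (f := fun ξ => derivWithin (fun s => op (E s a) ξ) I t) g
      (tendsto_pi_nhds.mpr hlim)
    have hd : ∀ ξ, d ξ = derivWithin (fun s => op (E s a) ξ) I t := fun ξ => rfl
    have hdA : d ∈ A := by
      rw [← VonNeumannAlgebra.commutant_commutant A, VonNeumannAlgebra.mem_commutant_iff]
      intro T hT
      rw [VonNeumannAlgebra.mem_commutant_iff] at hT
      ext ξ
      change T (d ξ) = d (T ξ)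
      have hg : ∀ s, T (g s ξ) = g s (T ξ) := by
        intro s
        have hs : op (E s a) (T ξ) = T (op (E s a) ξ) :=
          congrArg (fun S : H →L[ℂ] H => S ξ) (hT _ (E s a).2)
        have ht' : op (E t a) (T ξ) = T (op (E t a) ξ) :=
          congrArg (fun S : H →L[ℂ] H => S ξ) (hT _ (E t a).2)
        simp only [g, smul_apply, sub_apply, map_smul, map_sub]
        rw [hs, ht']
      refine tendsto_nhds_unique ((T.continuous.tendsto _).comp (hlim ξ)) ?_
      exact (hlim (T ξ)).congr (fun s => (hg s).symm)
    exact ⟨⟨d, hdA⟩, hd⟩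
  · exact ⟨0, fun ξ => by simp [derivWithin_zero_of_not_accPt hacc]⟩

theorem dE_apply {A : VonNeumannAlgebra H} {I : Set ℝ} {E : ℝ → Elem A →ₗ[ℂ] Elem A}
    (hE : IsSmoothPath I E) {t : ℝ} (ht : t ∈ I) (a : Elem A) (ξ : H) :
    op (dE I E t a) ξ = derivWithin (fun s => op (E s a) ξ) I t := by
  have h := exists_dE hE ht a
  rw [dE, dif_pos h]
  exact h.choose_spec ξ

/-- The local square integrability hypothesis: for every closed bounded interval `J = [c, d] ⊆ I`
there is a constant `C`, depending on `J` only, such that `∫_J ‖dE t (a)‖₂² dt ≤ C ‖a‖₂²` for all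
`a ∈ A`, where `‖a‖₂ = ‖a Ω‖` is the norm of `L²(A, τ)`. -/
def SquareIntegrableDerivative {A : VonNeumannAlgebra H} (Ω : H) (I : Set ℝ)
    (E : ℝ → Elem A →ₗ[ℂ] Elem A) : Prop :=
  ∀ c d : ℝ, Icc c d ⊆ I → ∃ C : ℝ, 0 < C ∧ ∀ a : Elem A,
    ∫ t in Icc c d, ‖op (dE I E t a) Ω‖ ^ 2 ≤ C * ‖op a Ω‖ ^ 2

/-- The right-hand side `[dE t, E t](a) = dE t (E t a) - E t (dE t a)` of the transport equation. -/
def transportField {A : VonNeumannAlgebra H} (I : Set ℝ) (E : ℝ → Elem A →ₗ[ℂ] Elem A) (t : ℝ)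
    (a : Elem A) : Elem A :=
  dE I E t (E t a) - E t (dE I E t a)

/-- `α` is a weak solution on `I` of the transport equation `α' = [dE t, E t](α)`: it is `A`-valued,
and for all `ξ ∈ H` the function `t ↦ ⟨α t, ξ⟩` is differentiable on `I` with derivative
`⟨[dE t, E t](α t), ξ⟩`. (Mathlib's `inner ℂ ξ η` is `⟨η, ξ⟩`, linear in `η`.) -/
def IsWeakSolution {A : VonNeumannAlgebra H} (Ω : H) (I : Set ℝ)
    (E : ℝ → Elem A →ₗ[ℂ] Elem A) (α : ℝ → Elem A) : Prop :=
  ∀ ξ : H, ∀ t ∈ I, HasDerivWithinAt (fun s => inner ℂ ξ (op (α s) Ω))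
    (inner ℂ ξ (op (transportField I E t (α t)) Ω)) I t

open Classical in
/-- The propagator `G_{t,s}` of the transport equation: `G_{t,s}(a) = α t`, where `α` is the weak
solution on `I` with `α s = a`. -/
def propagator {A : VonNeumannAlgebra H} (Ω : H) (I : Set ℝ) (E : ℝ → Elem A →ₗ[ℂ] Elem A)
    (t s : ℝ) (a : Elem A) : Elem A :=
  if h : ∃ α : ℝ → Elem A, IsWeakSolution Ω I E α ∧ α s = a then h.choose t else 0

end VNPath

end

/-!
The conditional expectation `E t` is the restriction to `A` of an orthogonal projection of
`H = L²(A, τ)`, and the transport equation is Kato's equation `v' = [dE, E] v` for a path of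
projections. It has to be solved twice at once: in `H`, where the generator is skew-adjoint, and in
`A`, where products make sense.

Both `E t` and `dE t` are symmetric for the inner product of `H` and, by the closed graph theorem
and the uniform boundedness principle, bounded for the operator norm of `A`, locally uniformly in
`t` (`exists_uniform_bound`). By the Krein–Lax theorem (`IsSymm.norm_apply_le`) a symmetric map
bounded for the operator norm is bounded in `H` as well. So the field `[dE, E]` extends to a
strongly continuous, locally bounded family of skew-adjoint operators on `H` (`exists_generator`).

Picard iteration solves the equation (`exists_solution_of_generator`). The pairs `(r, x Ω)` with
`x ∈ A`, `‖x‖ ≤ r` form a closed convex cone in `ℝ × H` (`isClosed_ballCone`), so that integrals and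
sums of `A`-valued curves are `A`-valued as soon as the operator norms can be summed. Uniqueness of
weak solutions holds because skew-adjointness makes their norm constant
(`eq_zero_of_weak_solution`).

Differentiating `E (E a) = E a` gives `E dE E = 0`; hence `E t (α t)` is a solution whenever `α` is,
and solutions starting in `B 0` stay in the `B t` (`IsStrongSolution.mem`). Differentiating the
multiplicativity of `E t` on its range shows that `dE t`, and so `[dE, E]`, is a derivation on
`B t` (`dE_mul_of_mem`). Products of solutions in the `B t` are therefore solutions, and so are
adjoints; by uniqueness the propagator is a `*`-homomorphism on `B 0`. Solving the equation
backwards in time shows that it is a bijection onto `B t`.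
-/

noncomputable section

namespace VNPath

variable {H : Type*} [NormedAddCommGroup H] [InnerProductSpace ℂ H] [CompleteSpace H]
  {A : VonNeumannAlgebra H} {τ : Elem A →ₗ[ℂ] ℂ} {Ω : H}

/-! ### The standard representation -/

/-- The map `a ↦ a Ω` identifying `A` with a dense subspace of `H`. -/
def vec (A : VonNeumannAlgebra H) (Ω : H) : Elem A →ₗ[ℂ] H where
  toFun a := op a Ω
  map_add' _ _ := rfl
  map_smul' _ _ := rfl

theorem IsStandardSpace.norm_sq (hΩ : IsStandardSpace A τ Ω) (a : Elem A) :
    ((‖op a Ω‖ ^ 2 : ℝ) : ℂ) = τ (star a * a) := by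
  rw [← hΩ.inner_eq, inner_self_eq_norm_sq_to_K]
  norm_cast

theorem norm_star_apply (hτ : IsFaithfulNormalTrace A τ) (hΩ : IsStandardSpace A τ Ω)
    (a : Elem A) : ‖op (star a) Ω‖ = ‖op a Ω‖ := by
  have h : ((‖op (star a) Ω‖ ^ 2 : ℝ) : ℂ) = ((‖op a Ω‖ ^ 2 : ℝ) : ℂ) := by
    rw [hΩ.norm_sq, hΩ.norm_sq, star_star, hτ.trace]
  have h' : ‖op (star a) Ω‖ ^ 2 = ‖op a Ω‖ ^ 2 := by exact_mod_cast h
  exact (pow_left_inj₀ (norm_nonneg _) (norm_nonneg _) two_ne_zero).1 h'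

theorem norm_op_star (a : Elem A) : ‖op (star a)‖ = ‖op a‖ :=
  norm_star (op a)

/-- Right multiplication is bounded for the norm of `L²(A, τ)`, because the adjoint is isometric. -/
theorem norm_mul_apply_le (hτ : IsFaithfulNormalTrace A τ) (hΩ : IsStandardSpace A τ Ω)
    (a b : Elem A) : ‖op (a * b) Ω‖ ≤ ‖op b‖ * ‖op a Ω‖ := by
  rw [← norm_star_apply hτ hΩ, star_mul, ← norm_star_apply hτ hΩ a, ← norm_op_star b]
  exact (op (star b)).le_opNorm _

theorem eq_of_apply_eq (hτ : IsFaithfulNormalTrace A τ) (hΩ : IsStandardSpace A τ Ω)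
    {a b : Elem A} (h : op a Ω = op b Ω) : a = b := by
  rw [← sub_eq_zero]
  apply hτ.faithful
  rw [← hΩ.norm_sq]
  have : op (a - b) Ω = 0 := by
    change op a Ω - op b Ω = 0
    rw [h, sub_self]
  rw [this]
  simp

/-- Right multiplication by `b`, as a bounded operator on `H`. -/
theorem exists_rightMul (hτ : IsFaithfulNormalTrace A τ) (hΩ : IsStandardSpace A τ Ω)
    (b : Elem A) : ∃ R : H →L[ℂ] H, ∀ a : Elem A, R (op a Ω) = op (a * b) Ω := by
  let f : Elem A →ₗ[ℂ] H := (vec A Ω).comp (LinearMap.mulRight ℂ b)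
  exact ⟨f.extendOfNorm (vec A Ω), fun a => LinearMap.extendOfNorm_eq (f := f) (e := vec A Ω)
    hΩ.dense ⟨‖op b‖, fun a => norm_mul_apply_le hτ hΩ a b⟩ a⟩

/-- If `xₙ Ω` converges and `‖xₙ‖ ≤ rₙ → r`, then the limit of `xₙ Ω` is `x Ω` for an element
`x` of `A` with `‖x‖ ≤ r`: since `xₙ (b Ω) = R_b (xₙ Ω)`, the operators `xₙ` converge on a dense
subspace, hence strongly. -/
theorem exists_limit (hτ : IsFaithfulNormalTrace A τ) (hΩ : IsStandardSpace A τ Ω)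
    {x : ℕ → Elem A} {r : ℕ → ℝ} {r₀ : ℝ} {v : H} (hx : ∀ n, ‖op (x n)‖ ≤ r n)
    (hr : Tendsto r atTop (𝓝 r₀)) (hv : Tendsto (fun n => op (x n) Ω) atTop (𝓝 v)) :
    ∃ y : Elem A, op y Ω = v ∧ ‖op y‖ ≤ r₀ := by
  choose R hR using exists_rightMul hτ hΩ
  have hlim : ∀ b, Tendsto (fun n => op (x n) (op b Ω)) atTop (𝓝 (R b v)) := fun b =>
    (((R b).continuous.tendsto v).comp hv).congr fun n => hR b (x n)
  have hr₀ : 0 ≤ r₀ := ge_of_tendsto' hr fun n => (norm_nonneg _).trans (hx n)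
  have hbound : ∀ b, ‖R b v‖ ≤ r₀ * ‖op b Ω‖ := fun b =>
    le_of_tendsto_of_tendsto' (hlim b).norm (hr.mul_const _) fun n =>
      ((op (x n)).le_opNorm _).trans (by gcongr; exact hx n)
  let f : Elem A →ₗ[ℂ] H :=
    { toFun := fun b => R b v
      map_add' := fun b c => tendsto_nhds_unique (hlim (b + c))
        (((hlim b).add (hlim c)).congr fun n => by
          change _ = op (x n) (op b Ω + op c Ω)
          rw [map_add])
      map_smul' := fun k b => tendsto_nhds_unique (hlim (k • b))
        (((hlim b).const_smul k).congr fun n => by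
          change _ = op (x n) (k • op b Ω)
          rw [map_smul]) }
  let y : H →L[ℂ] H := f.extendOfNorm (vec A Ω)
  have hy : ∀ b : Elem A, y (op b Ω) = R b v := fun b =>
    LinearMap.extendOfNorm_eq (f := f) (e := vec A Ω) hΩ.dense ⟨r₀, hbound⟩ b
  have hyn : ‖y‖ ≤ r₀ :=
    LinearMap.opNorm_extendOfNorm_le (f := f) (e := vec A Ω) hΩ.dense hr₀ hbound
  -- the operators converge strongly, by boundedness and density
  have hstrong : ∀ ξ, Tendsto (fun n => op (x n) ξ) atTop (𝓝 (y ξ)) := by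
    intro ξ
    rw [Metric.tendsto_atTop]
    intro ε hε
    have hδ : 0 < ε / (3 * (r₀ + 1)) := by positivity
    obtain ⟨b, hb⟩ := hΩ.dense.exists_dist_lt ξ hδ
    have hrn : ∀ᶠ n in atTop, r n < r₀ + 1 := hr.eventually_lt_const (by linarith)
    have hcl := (Metric.tendsto_nhds.1 (hlim b)) (ε / 3) (by positivity)
    obtain ⟨N, hN⟩ := eventually_atTop.1 (hrn.and hcl)
    refine ⟨N, fun n hn => ?_⟩
    obtain ⟨h1, h2⟩ := hN n hn
    rw [dist_eq_norm] at h2 hb ⊢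
    have hsmall : (r₀ + 1) * ‖ξ - op b Ω‖ < ε / 3 := by
      calc (r₀ + 1) * ‖ξ - op b Ω‖ < (r₀ + 1) * (ε / (3 * (r₀ + 1))) := by gcongr
        _ = ε / 3 := by field_simp
    have e : op (x n) ξ - y ξ
        = op (x n) (ξ - op b Ω) + (op (x n) (op b Ω) - R b v) - y (ξ - op b Ω) := by
      rw [map_sub, map_sub, hy]; abel
    have b1 : ‖op (x n) (ξ - op b Ω)‖ ≤ (r₀ + 1) * ‖ξ - op b Ω‖ :=
      ((op (x n)).le_opNorm _).trans (by gcongr; exact (hx n).trans h1.le)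
    have b2 : ‖y (ξ - op b Ω)‖ ≤ (r₀ + 1) * ‖ξ - op b Ω‖ :=
      (y.le_opNorm _).trans (by gcongr; linarith)
    rw [e]
    refine (norm_sub_le _ _).trans_lt ?_
    have := norm_add_le (op (x n) (ξ - op b Ω)) (op (x n) (op b Ω) - R b v)
    linarith
  have hyA : y ∈ A := by
    rw [← VonNeumannAlgebra.commutant_commutant A, VonNeumannAlgebra.mem_commutant_iff]
    intro T hT
    rw [VonNeumannAlgebra.mem_commutant_iff] at hT
    ext ξ
    refine tendsto_nhds_unique ((T.continuous.tendsto _).comp (hstrong ξ)) ?_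
    exact (hstrong (T ξ)).congr fun n =>
      congrArg (fun S : H →L[ℂ] H => S ξ) (hT _ (x n).2)
  exact ⟨⟨y, hyA⟩, tendsto_nhds_unique (hstrong Ω) hv, hyn⟩

/-- The cone over the unit ball of `A`, seen in `ℝ × H`: the pairs `(r, x Ω)` with `‖x‖ ≤ r`. -/
def ballCone (A : VonNeumannAlgebra H) (Ω : H) : Set (ℝ × H) :=
  {p | ∃ x : Elem A, op x Ω = p.2 ∧ ‖op x‖ ≤ p.1}

theorem isClosed_ballCone (hτ : IsFaithfulNormalTrace A τ) (hΩ : IsStandardSpace A τ Ω) :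
    IsClosed (ballCone A Ω) := by
  refine IsSeqClosed.isClosed fun p q hp hq => ?_
  choose x hx hxr using hp
  refine exists_limit hτ hΩ hxr ((continuous_fst.tendsto q).comp hq) ?_
  exact ((continuous_snd.tendsto q).comp hq).congr fun n => (hx n).symm

theorem ballCone_add {p q : ℝ × H} (hp : p ∈ ballCone A Ω) (hq : q ∈ ballCone A Ω) :
    p + q ∈ ballCone A Ω := by
  obtain ⟨x, hx, hxr⟩ := hp
  obtain ⟨y, hy, hyr⟩ := hq
  refine ⟨x + y, ?_, (norm_add_le (op x) (op y)).trans (add_le_add hxr hyr)⟩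
  rw [Prod.snd_add, ← hx, ← hy]
  rfl

theorem ballCone_smul {p : ℝ × H} (hp : p ∈ ballCone A Ω) (c : ℝ) :
    (|c| * p.1, c • p.2) ∈ ballCone A Ω := by
  obtain ⟨x, hx, hxr⟩ := hp
  refine ⟨(c : ℂ) • x, ?_, ?_⟩
  · change (c : ℂ) • op x Ω = _
    rw [hx, Complex.coe_smul]
  · change ‖(c : ℂ) • op x‖ ≤ _
    rw [norm_smul, Complex.norm_real, Real.norm_eq_abs]
    exact mul_le_mul_of_nonneg_left hxr (abs_nonneg c)

theorem ballCone_mono {r r' : ℝ} {v : H} (h : (r, v) ∈ ballCone A Ω) (hr : r ≤ r') :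
    (r', v) ∈ ballCone A Ω := by
  obtain ⟨x, hx, hxr⟩ := h
  exact ⟨x, hx, hxr.trans hr⟩

theorem norm_le_of_mem_ballCone {r : ℝ} {v : H} (h : (r, v) ∈ ballCone A Ω) :
    ‖v‖ ≤ r * ‖Ω‖ := by
  obtain ⟨x, hx, hxr⟩ := h
  change op x Ω = v at hx
  rw [← hx]
  exact ((op x).le_opNorm Ω).trans (mul_le_mul_of_nonneg_right hxr (norm_nonneg _))

theorem convex_ballCone : Convex ℝ (ballCone A Ω) := by
  intro p hp q hq a b ha hb _
  have h := ballCone_add (ballCone_smul hp a) (ballCone_smul hq b)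
  rwa [abs_of_nonneg ha, abs_of_nonneg hb] at h

instance : CompleteSpace (Elem A) := by
  have h : IsClosed (A : Set (H →L[ℂ] H)) := by
    rw [← VonNeumannAlgebra.centralizer_centralizer A]
    exact Set.isClosed_centralizer _
  exact h.completeSpace_coe

/-! ### Conditional expectations -/

theorem IsTraceCondExp.map_isSelfAdjoint {B : VonNeumannAlgebra H} {E : Elem A →ₗ[ℂ] Elem A}
    (hE : IsTraceCondExp A B τ E) {a : Elem A} (ha : star a = a) : star (E a) = E a := by
  have key : ∀ p : Elem A, (op p).IsPositive → star (E p) = E p := fun p hp =>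
    Subtype.ext (hE.positive p hp).isSelfAdjoint.star_eq
  have hsa : IsSelfAdjoint (op a) := congrArg op ha
  let c : Elem A := (‖op a‖ : ℂ) • 1
  have hop : op c = algebraMap ℝ (H →L[ℂ] H) ‖op a‖ := by
    rw [Algebra.algebraMap_eq_smul_one, ← Complex.coe_smul]
    rfl
  have hc : (op c).IsPositive := by
    have : (0 : H →L[ℂ] H) ≤ algebraMap ℝ (H →L[ℂ] H) ‖op a‖ :=
      (algebraMap_nonneg _ (norm_nonneg _))
    rw [ContinuousLinearMap.nonneg_iff_isPositive] at this
    rwa [hop]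
  have hca : (op (c - a)).IsPositive := by
    have := hsa.le_algebraMap_norm_self
    rwa [ContinuousLinearMap.le_def, ← hop] at this
  have e : E a = E c - E (c - a) := by rw [map_sub, sub_sub_cancel]
  rw [e, star_sub, key _ hc, key _ hca]

theorem IsTraceCondExp.map_star {B : VonNeumannAlgebra H} {E : Elem A →ₗ[ℂ] Elem A}
    (hE : IsTraceCondExp A B τ E) (a : Elem A) : E (star a) = star (E a) := by
  have h := realPart_add_I_smul_imaginaryPart a
  have h1 : star ((realPart a : Elem A)) = realPart a := (realPart a).2
  have h2 : star ((imaginaryPart a : Elem A)) = imaginaryPart a := (imaginaryPart a).2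
  rw [← h, star_add, star_smul, h1, h2, map_add, map_smul, map_add, map_smul, star_add, star_smul,
    hE.map_isSelfAdjoint h1, hE.map_isSelfAdjoint h2]

theorem IsTraceCondExp.map_mul_right {B : VonNeumannAlgebra H} {E : Elem A →ₗ[ℂ] Elem A}
    (hE : IsTraceCondExp A B τ E) (a : Elem A) {b : Elem A} (hb : op b ∈ B) :
    E (a * b) = E a * b := by
  have h := hE.bimodule a 1 b (one_mem B) hb
  rwa [one_mul, one_mul] at h

theorem IsTraceCondExp.map_mul_left {B : VonNeumannAlgebra H} {E : Elem A →ₗ[ℂ] Elem A}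
    (hE : IsTraceCondExp A B τ E) (a : Elem A) {b : Elem A} (hb : op b ∈ B) :
    E (b * a) = b * E a := by
  have h := hE.bimodule a b 1 hb (one_mem B)
  rwa [mul_one, mul_one] at h

/-- Symmetry of a linear map on `A` for the inner product of `L²(A, τ)`. -/
def IsSymm (Ω : H) (T : Elem A →ₗ[ℂ] Elem A) : Prop :=
  ∀ a b : Elem A, inner ℂ (op (T a) Ω) (op b Ω) = inner ℂ (op a Ω) (op (T b) Ω)

theorem IsTraceCondExp.isSymm (hΩ : IsStandardSpace A τ Ω) {B : VonNeumannAlgebra H}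
    {E : Elem A →ₗ[ℂ] Elem A} (hE : IsTraceCondExp A B τ E) : IsSymm Ω E := by
  intro a b
  rw [hΩ.inner_eq, hΩ.inner_eq, ← hE.map_star, ← hE.trace_eq (E (star a) * b),
    ← hE.trace_eq (star a * E b), hE.map_mul_left b (hE.mem (star a)),
    hE.map_mul_right (star a) (hE.mem b)]

/-! ### Symmetric maps on `A` -/

/-- A symmetric map is closed for the operator norm, hence bounded. -/
theorem IsSymm.continuous (hτ : IsFaithfulNormalTrace A τ) (hΩ : IsStandardSpace A τ Ω)
    {T : Elem A →ₗ[ℂ] Elem A} (hT : IsSymm Ω T) : Continuous T := by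
  have hev : Continuous fun a : Elem A => op a Ω :=
    (ContinuousLinearMap.apply ℂ H Ω).continuous.comp continuous_subtype_val
  refine LinearMap.continuous_of_seq_closed_graph T fun u x y hu hTu => ?_
  apply eq_of_apply_eq hτ hΩ
  -- both sides have the same inner products with the vectors `b Ω`
  have h : ∀ b : Elem A, inner ℂ (op y Ω) (op b Ω) = inner ℂ (op (T x) Ω) (op b Ω) := by
    intro b
    have h1 : Tendsto (fun n => inner ℂ (op (T (u n)) Ω) (op b Ω)) atTop
        (𝓝 (inner ℂ (op y Ω) (op b Ω))) :=
      ((hev.tendsto y).comp hTu).inner tendsto_const_nhds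
    have h2 : Tendsto (fun n => inner ℂ (op (u n) Ω) (op (T b) Ω)) atTop
        (𝓝 (inner ℂ (op x Ω) (op (T b) Ω))) :=
      ((hev.tendsto x).comp hu).inner tendsto_const_nhds
    rw [hT x b]
    exact tendsto_nhds_unique h1 (h2.congr fun n => (hT (u n) b).symm)
  refine ext_inner_right ℂ fun v => ?_
  exact congrFun (hΩ.dense.equalizer (by fun_prop) (by fun_prop) (funext h)) v

/-- The Krein–Lax theorem: a map that is symmetric for the inner product of `L²(A, τ)` and bounded
by `K` for the operator norm is bounded by `K` on `L²(A, τ)`. Iterating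
`‖(T ^ n) a‖₂ ^ 2 ≤ ‖(T ^ (2 * n)) a‖₂ * ‖a‖₂` gives
`(‖T a‖₂ / ‖a‖₂) ^ n ≤ K ^ n * ‖a‖ * ‖Ω‖ / ‖a‖₂` for the powers `n` of `2`. -/
theorem IsSymm.norm_apply_le {T : Elem A →ₗ[ℂ] Elem A} (hT : IsSymm Ω T) {K : ℝ} (hK : 0 ≤ K)
    (hTK : ∀ a, ‖op (T a)‖ ≤ K * ‖op a‖) (a : Elem A) : ‖op (T a) Ω‖ ≤ K * ‖op a Ω‖ := by
  have hpow : ∀ n : ℕ, IsSymm Ω (T ^ n) := by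
    intro n
    induction n with
    | zero => exact fun _ _ => rfl
    | succ n ih =>
      intro b c
      rw [pow_succ, Module.End.mul_apply, ih, hT, ← Module.End.mul_apply, ← pow_succ', ← pow_succ]
  have hpowK : ∀ n : ℕ, ‖op ((T ^ n) a)‖ ≤ K ^ n * ‖op a‖ := by
    intro n
    induction n with
    | zero => simp
    | succ n ih =>
      rw [pow_succ', Module.End.mul_apply, pow_succ', mul_assoc]
      exact (hTK _).trans (by gcongr)
  set m : ℕ → ℝ := fun n => ‖op ((T ^ n) a) Ω‖ with hm
  have hm_nonneg : ∀ n, 0 ≤ m n := fun n => norm_nonneg _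
  have hsq : ∀ n, m n ^ 2 ≤ m (2 * n) * m 0 := by
    intro n
    have h1 : (inner ℂ (op ((T ^ n) a) Ω) (op ((T ^ n) a) Ω) : ℂ) = (m n : ℂ) ^ 2 :=
      inner_self_eq_norm_sq_to_K _
    rw [← hpow, ← Module.End.mul_apply, ← pow_add, ← two_mul] at h1
    have h2 := norm_inner_le_norm (𝕜 := ℂ) (op ((T ^ (2 * n)) a) Ω) (op a Ω)
    rw [h1, norm_pow, Complex.norm_real, Real.norm_of_nonneg (hm_nonneg n)] at h2
    exact h2
  set L : ℝ := ‖op a‖ * ‖Ω‖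
  have hmL : ∀ n, m n ≤ K ^ n * L := fun n => by
    rw [← mul_assoc]
    exact ((op ((T ^ n) a)).le_opNorm Ω).trans (by gcongr; exact hpowK n)
  change m 1 ≤ K * m 0
  rcases (hm_nonneg 0).eq_or_lt with h0 | h0
  · have := hsq 1
    rw [← h0, mul_zero] at this ⊢
    nlinarith [hm_nonneg 1]
  have hind : ∀ k : ℕ, m 1 ^ 2 ^ k * m 0 ≤ m (2 ^ k) * m 0 ^ 2 ^ k := by
    intro k
    induction k with
    | zero => simp
    | succ k ih =>
      have h1 := pow_le_pow_left₀ (mul_nonneg (pow_nonneg (hm_nonneg 1) _) h0.le) ih 2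
      have h2 := hsq (2 ^ k)
      refine le_of_mul_le_mul_right ?_ h0
      calc m 1 ^ 2 ^ (k + 1) * m 0 * m 0 = (m 1 ^ 2 ^ k * m 0) ^ 2 := by ring
        _ ≤ (m (2 ^ k) * m 0 ^ 2 ^ k) ^ 2 := h1
        _ = m (2 ^ k) ^ 2 * m 0 ^ 2 ^ (k + 1) := by ring
        _ ≤ m (2 * 2 ^ k) * m 0 * m 0 ^ 2 ^ (k + 1) := by gcongr
        _ = m (2 ^ (k + 1)) * m 0 ^ 2 ^ (k + 1) * m 0 := by
          rw [← pow_succ', mul_right_comm]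
  have hall : ∀ k : ℕ, m 1 ^ 2 ^ k * m 0 ≤ (K * m 0) ^ 2 ^ k * L := fun k => by
    refine (hind k).trans ?_
    rw [mul_pow, mul_right_comm]
    gcongr
    exact hmL _
  by_contra! hlt
  have hKm : 0 ≤ K * m 0 := mul_nonneg hK h0.le
  have hpos : 0 < K * m 0 := by
    refine hKm.lt_of_ne fun h => ?_
    have := hall 0
    rw [← h] at this hlt
    simp only [pow_zero, pow_one, zero_mul] at this
    exact this.not_gt (mul_pos hlt h0)
  obtain ⟨n, hn⟩ := pow_unbounded_of_one_lt (L / m 0) ((one_lt_div hpos).2 hlt)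
  have h1 : (m 1 / (K * m 0)) ^ n ≤ (m 1 / (K * m 0)) ^ 2 ^ n :=
    pow_le_pow_right₀ ((one_lt_div hpos).2 hlt).le Nat.lt_two_pow_self.le
  have h2 : (m 1 / (K * m 0)) ^ 2 ^ n ≤ L / m 0 := by
    rw [div_pow, div_le_div_iff₀ (by positivity) h0, mul_comm L]
    exact hall n
  linarith

theorem exists_uniform_bound (hτ : IsFaithfulNormalTrace A τ) (hΩ : IsStandardSpace A τ Ω)
    {J : Set ℝ} (hJ : IsCompact J) {T : ℝ → Elem A →ₗ[ℂ] Elem A} (hT : ∀ t ∈ J, IsSymm Ω (T t))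
    (hc : ∀ (a : Elem A) (ξ : H), ContinuousOn (fun t => op (T t a) ξ) J) :
    ∃ K : ℝ, 0 ≤ K ∧ ∀ t ∈ J, ∀ a, ‖op (T t a)‖ ≤ K * ‖op a‖ := by
  have h1 : ∀ a : Elem A, ∃ C, ∀ t : J, ‖op (T t a)‖ ≤ C := fun a =>
    banach_steinhaus fun ξ => by
      obtain ⟨C, hC⟩ := (hJ.image_of_continuousOn (hc a ξ)).isBounded.exists_norm_le
      exact ⟨C, fun t => hC _ (mem_image_of_mem _ t.2)⟩
  let S : J → Elem A →L[ℂ] Elem A := fun t => ⟨T t, (hT t t.2).continuous hτ hΩ⟩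
  obtain ⟨K, hK⟩ := banach_steinhaus (g := S) h1
  refine ⟨max K 0, le_max_right _ _, fun t ht a => ?_⟩
  exact ((S ⟨t, ht⟩).le_opNorm a).trans
    (mul_le_mul_of_nonneg_right ((hK _).trans (le_max_left _ _)) (norm_nonneg _))

/-- A strongly continuous family of symmetric maps on `A` extends to a family of operators on `H`,
and is locally bounded both on `H` and for the operator norm of `A`. -/
theorem exists_extension (hτ : IsFaithfulNormalTrace A τ) (hΩ : IsStandardSpace A τ Ω)
    {I : Set ℝ} {T : ℝ → Elem A →ₗ[ℂ] Elem A} (hT : ∀ t ∈ I, IsSymm Ω (T t))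
    (hc : ∀ (a : Elem A) (ξ : H), ContinuousOn (fun t => op (T t a) ξ) I) :
    ∃ S : ℝ → H →L[ℂ] H, (∀ t ∈ I, ∀ a : Elem A, S t (op a Ω) = op (T t a) Ω) ∧
      ∀ c d, Icc c d ⊆ I → ∃ K : ℝ, 0 ≤ K ∧
        ∀ t ∈ Icc c d, ‖S t‖ ≤ K ∧ ∀ a, ‖op (T t a)‖ ≤ K * ‖op a‖ := by
  have hb : ∀ c d, Icc c d ⊆ I → ∃ K : ℝ, 0 ≤ K ∧
      ∀ t ∈ Icc c d, ∀ a, ‖op (T t a)‖ ≤ K * ‖op a‖ := fun c d h =>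
    exists_uniform_bound hτ hΩ isCompact_Icc (fun t ht => hT t (h ht)) fun a ξ => (hc a ξ).mono h
  refine ⟨fun t => ((vec A Ω).comp (T t)).extendOfNorm (vec A Ω), fun t ht a => ?_,
    fun c d h => ?_⟩
  · obtain ⟨K, hK, hTK⟩ := hb t t (by simpa using ht)
    exact LinearMap.extendOfNorm_eq (f := (vec A Ω).comp (T t)) (e := vec A Ω) hΩ.dense
      ⟨K, (hT t ht).norm_apply_le hK (hTK t (by simp))⟩ a
  · obtain ⟨K, hK, hTK⟩ := hb c d h
    exact ⟨K, hK, fun t ht => ⟨LinearMap.opNorm_extendOfNorm_le (f := (vec A Ω).comp (T t))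
      (e := vec A Ω) hΩ.dense hK ((hT t (h ht)).norm_apply_le hK (hTK t ht)), hTK t ht⟩⟩

/-! ### Calculus on an interval -/

theorem exists_Icc_mem_nhdsWithin {I : Set ℝ} (hI : I.OrdConnected) {s t : ℝ} (hs : s ∈ I)
    (ht : t ∈ I) :
    ∃ c d, Icc c d ⊆ I ∧ s ∈ Icc c d ∧ t ∈ Icc c d ∧ Icc c d ∈ 𝓝[I] t := by
  have hd : ∃ d ∈ I, t ≤ d ∧ s ≤ d ∧ Iic d ∈ 𝓝[I] t := by
    by_cases h : ∃ y ∈ I, t < y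
    · obtain ⟨y, hy, hty⟩ := h
      refine ⟨max y s, ?_, hty.le.trans (le_max_left _ _), le_max_right _ _,
        mem_nhdsWithin_of_mem_nhds (Iic_mem_nhds (hty.trans_le (le_max_left _ _)))⟩
      rcases max_choice y s with h | h <;> rwa [h]
    · push Not at h
      exact ⟨t, ht, le_rfl, h s hs, mem_of_superset self_mem_nhdsWithin h⟩
  have hc : ∃ c ∈ I, c ≤ t ∧ c ≤ s ∧ Ici c ∈ 𝓝[I] t := by
    by_cases h : ∃ y ∈ I, y < t
    · obtain ⟨y, hy, hty⟩ := h
      refine ⟨min y s, ?_, (min_le_left _ _).trans hty.le, min_le_right _ _,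
        mem_nhdsWithin_of_mem_nhds (Ici_mem_nhds ((min_le_left _ _).trans_lt hty))⟩
      rcases min_choice y s with h | h <;> rwa [h]
    · push Not at h
      exact ⟨t, ht, le_rfl, h s hs, mem_of_superset self_mem_nhdsWithin h⟩
  obtain ⟨d, hdI, htd, hsd, hd⟩ := hd
  obtain ⟨c, hcI, hct, hcs, hc⟩ := hc
  exact ⟨c, d, hI.out hcI hdI, ⟨hcs, hsd⟩, ⟨hct, htd⟩, inter_mem hc hd⟩

/-- A locally bounded family of operators that is continuous at the vectors of a dense set is
jointly continuous. -/
theorem continuousOn_apply_of_dense {F : Type*} [NormedAddCommGroup F] [NormedSpace ℂ F]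
    {ι : Type*} {e : ι → F} (he : DenseRange e) {I : Set ℝ} (hI : I.OrdConnected)
    {S : ℝ → F →L[ℂ] F}
    (hb : ∀ c d, Icc c d ⊆ I → ∃ K : ℝ, ∀ t ∈ Icc c d, ‖S t‖ ≤ K)
    (hc : ∀ i, ContinuousOn (fun t => S t (e i)) I) {u : ℝ → F} (hu : ContinuousOn u I) :
    ContinuousOn (fun t => S t (u t)) I := by
  intro t ht
  obtain ⟨c, d, hcd, -, htcd, hn⟩ := exists_Icc_mem_nhdsWithin hI ht ht
  obtain ⟨K, hK⟩ := hb c d hcd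
  have hK0 : 0 ≤ K := (norm_nonneg _).trans (hK t htcd)
  rw [ContinuousWithinAt, Metric.tendsto_nhds]
  intro ε hε
  have hδ : 0 < ε / (4 * (K + 1)) := by positivity
  obtain ⟨i, hi⟩ := he.exists_dist_lt (u t) hδ
  filter_upwards [hn, Metric.tendsto_nhds.1 (hc i t ht) (ε / 4) (by positivity),
    Metric.tendsto_nhds.1 (hu t ht) _ hδ] with s hs h1 h2
  rw [dist_eq_norm] at h1 h2 hi ⊢
  have hsplit : S s (u s) - S t (u t) = S s (u s - u t) + S s (u t - e i)
      + (S s (e i) - S t (e i)) - S t (u t - e i) := by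
    simp only [map_sub]; abel
  have hsmall : ∀ r ∈ Icc c d, ∀ v : F, ‖v‖ < ε / (4 * (K + 1)) → ‖S r v‖ < ε / 4 := by
    intro r hr v hv
    calc ‖S r v‖ ≤ (K + 1) * ‖v‖ :=
          ((S r).le_opNorm v).trans (by gcongr; linarith [hK r hr])
      _ < (K + 1) * (ε / (4 * (K + 1))) := by gcongr
      _ = ε / 4 := by field_simp
  rw [hsplit]
  have b1 := hsmall s hs _ h2
  have b2 := hsmall s hs _ hi
  have b3 := hsmall t htcd _ hi
  calc _ ≤ ‖S s (u s - u t) + S s (u t - e i) + (S s (e i) - S t (e i))‖ + ‖S t (u t - e i)‖ :=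
        norm_sub_le _ _
    _ ≤ ‖S s (u s - u t)‖ + ‖S s (u t - e i)‖ + ‖S s (e i) - S t (e i)‖ + ‖S t (u t - e i)‖ := by
        gcongr; exact norm_add₃_le
    _ < ε := by linarith

/-- The fundamental theorem of calculus on an interval, one-sided at the endpoints. -/
theorem hasDerivWithinAt_integral {F : Type*} [NormedAddCommGroup F] [NormedSpace ℝ F]
    [CompleteSpace F] {I : Set ℝ} (hI : I.OrdConnected) {f : ℝ → F}
    (hf : ContinuousOn f I) {s t : ℝ} (hs : s ∈ I) (ht : t ∈ I) :
    HasDerivWithinAt (fun r => ∫ x in s..r, f x) (f t) I t := by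
  obtain ⟨c, d, hcd, hscd, htcd, hn⟩ := exists_Icc_mem_nhdsWithin hI hs ht
  have hle : c ≤ d := htcd.1.trans htcd.2
  have hg : Continuous fun x => f (projIcc c d hle x) :=
    (hf.mono hcd).comp_continuous (continuous_subtype_val.comp continuous_projIcc) fun x =>
      (projIcc c d hle x).2
  have hfg : ∀ x ∈ Icc c d, f (projIcc c d hle x) = f x := fun x hx => by
    rw [projIcc_of_mem hle hx]
  have h := (hg.integral_hasStrictDerivAt s t).hasDerivAt.hasDerivWithinAt (s := I)
  rw [hfg t htcd] at h
  have hev : ∀ r ∈ Icc c d, ∫ x in s..r, f x = ∫ x in s..r, f (projIcc c d hle x) := fun r hr =>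
    intervalIntegral.integral_congr fun x hx =>
      (hfg x (ordConnected_Icc.uIcc_subset hscd hr hx)).symm
  exact h.congr_of_eventuallyEq (mem_of_superset hn hev) (hev t htcd)

/-- The product rule for `s ↦ S s (u s)`, where the operators `S s` need only be differentiable at
the vector `u t`. -/
theorem hasDerivWithinAt_apply {F : Type*} [NormedAddCommGroup F] [NormedSpace ℂ F] {I : Set ℝ}
    {t : ℝ} {S : ℝ → F →L[ℂ] F} {u : ℝ → F} {u' d : F} {K : ℝ} (hb : ∀ᶠ s in 𝓝[I] t, ‖S s‖ ≤ K)
    (hu : HasDerivWithinAt u u' I t) (hd : HasDerivWithinAt (fun s => S s (u t)) d I t)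
    (hc : ContinuousWithinAt (fun s => S s u') I t) :
    HasDerivWithinAt (fun s => S s (u s)) (d + S t u') I t := by
  rw [hasDerivWithinAt_iff_isLittleO] at hu hd ⊢
  have h1 : (fun s => S s (u s - u t - (s - t) • u')) =o[𝓝[I] t] fun s => s - t := by
    refine (Asymptotics.IsBigO.of_bound K ?_).trans_isLittleO hu
    filter_upwards [hb] with s hs
    exact ((S s).le_opNorm _).trans (by gcongr)
  have h2 : (fun s => (s - t) • (S s u' - S t u')) =o[𝓝[I] t] fun s => s - t := by
    have h0 : Tendsto (fun s => S s u' - S t u') (𝓝[I] t) (𝓝 0) := by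
      rw [← sub_self (S t u')]
      exact hc.tendsto.sub_const _
    have := (Asymptotics.isBigO_refl (fun s : ℝ => s - t) (𝓝[I] t)).smul_isLittleO
      ((Asymptotics.isLittleO_one_iff ℝ).2 h0)
    simpa using this
  refine ((h1.add hd).add h2).congr_left fun s => ?_
  simp only [map_sub, smul_sub, smul_add]
  rw [← Complex.coe_smul (s - t) u', map_smul, Complex.coe_smul]
  abel

theorem hasDerivWithinAt_mul (hτ : IsFaithfulNormalTrace A τ) (hΩ : IsStandardSpace A τ Ω)
    {I : Set ℝ} {t : ℝ} {x y : ℝ → Elem A} {x' y' : Elem A} {K : ℝ}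
    (hb : ∀ᶠ s in 𝓝[I] t, ‖op (x s)‖ ≤ K)
    (hx : HasDerivWithinAt (fun s => op (x s) Ω) (op x' Ω) I t)
    (hy : HasDerivWithinAt (fun s => op (y s) Ω) (op y' Ω) I t) :
    HasDerivWithinAt (fun s => op (x s * y s) Ω) (op (x' * y t + x t * y') Ω) I t := by
  choose R hR using exists_rightMul hτ hΩ
  refine hasDerivWithinAt_apply (S := fun s => op (x s)) hb hy ?_ ?_
  · have h := ((R (y t)).restrictScalars ℝ).hasFDerivAt.comp_hasDerivWithinAt t hx
    have e : (R (y t)) (op x' Ω) = op (x' * y t) Ω := hR _ _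
    exact (h.congr_deriv e).congr_of_eventuallyEq
      (Eventually.of_forall fun s => (hR (y t) (x s)).symm) (hR (y t) (x t)).symm
  · exact ((R y').continuous.continuousAt.comp_continuousWithinAt hx.continuousWithinAt).congr
      (fun s _ => (hR y' (x s)).symm) (hR y' (x t)).symm

theorem hasDerivWithinAt_star (hτ : IsFaithfulNormalTrace A τ) (hΩ : IsStandardSpace A τ Ω)
    {I : Set ℝ} {t : ℝ} {x : ℝ → Elem A} {x' : Elem A}
    (hx : HasDerivWithinAt (fun s => op (x s) Ω) (op x' Ω) I t) :
    HasDerivWithinAt (fun s => op (star (x s)) Ω) (op (star x') Ω) I t := by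
  rw [hasDerivWithinAt_iff_isLittleO] at hx ⊢
  refine hx.norm_left.congr' (Eventually.of_forall fun s => ?_) EventuallyEq.rfl |>.of_norm_left
  have h := norm_star_apply hτ hΩ (x s - x t - ((s - t : ℝ) : ℂ) • x')
  rw [star_sub, star_sub, star_smul, Complex.star_def, Complex.conj_ofReal] at h
  exact h.symm

/-! ### The derivative of the path of conditional expectations -/

section Derivative

variable {I : Set ℝ} {B : ℝ → VonNeumannAlgebra H} {E : ℝ → Elem A →ₗ[ℂ] Elem A}

theorem hasDerivWithinAt_dE (hsmooth : IsSmoothPath I E) {t : ℝ} (ht : t ∈ I) (a : Elem A)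
    (ξ : H) : HasDerivWithinAt (fun s => op (E s a) ξ) (op (dE I E t a) ξ) I t := by
  rw [dE_apply hsmooth ht]
  exact ((hsmooth a ξ).differentiableOn one_ne_zero t ht).hasDerivWithinAt

theorem dE_eq_of_hasDerivWithinAt (hτ : IsFaithfulNormalTrace A τ)
    (hΩ : IsStandardSpace A τ Ω) (hU : UniqueDiffOn ℝ I) (hsmooth : IsSmoothPath I E) {t : ℝ}
    (ht : t ∈ I) {a d : Elem A}
    (h : HasDerivWithinAt (fun s => op (E s a) Ω) (op d Ω) I t) : dE I E t a = d :=
  eq_of_apply_eq hτ hΩ ((hU t ht).eq_deriv I (hasDerivWithinAt_dE hsmooth ht a Ω) h)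

theorem continuousOn_dE (hU : UniqueDiffOn ℝ I) (hsmooth : IsSmoothPath I E) (a : Elem A)
    (ξ : H) : ContinuousOn (fun t => op (dE I E t a) ξ) I :=
  ((hsmooth a ξ).continuousOn_derivWithin hU le_rfl).congr fun _ ht => dE_apply hsmooth ht a ξ

theorem exists_dE_linear (hτ : IsFaithfulNormalTrace A τ) (hΩ : IsStandardSpace A τ Ω)
    (hU : UniqueDiffOn ℝ I) (hsmooth : IsSmoothPath I E) :
    ∃ D : ℝ → Elem A →ₗ[ℂ] Elem A, ∀ t ∈ I, ∀ a, D t a = dE I E t a := by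
  have h : ∀ t, ∃ D : Elem A →ₗ[ℂ] Elem A, t ∈ I → ∀ a, D a = dE I E t a := by
    intro t
    by_cases ht : t ∈ I
    · refine ⟨{ toFun := dE I E t, map_add' := fun a b => ?_, map_smul' := fun k a => ?_ },
        fun _ _ => rfl⟩
      · apply dE_eq_of_hasDerivWithinAt hτ hΩ hU hsmooth ht
        refine ((hasDerivWithinAt_dE hsmooth ht a Ω).add
          (hasDerivWithinAt_dE hsmooth ht b Ω)).congr_of_eventuallyEq
          (Eventually.of_forall fun s => ?_) ?_ <;> simp only [map_add] <;> rfl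
      · apply dE_eq_of_hasDerivWithinAt hτ hΩ hU hsmooth ht
        refine ((hasDerivWithinAt_dE hsmooth ht a Ω).const_smul k).congr_of_eventuallyEq
          (Eventually.of_forall fun s => ?_) ?_ <;> simp only [map_smul] <;> rfl
    · exact ⟨0, fun h => absurd h ht⟩
  choose D hD using h
  exact ⟨D, hD⟩

theorem inner_dE (hΩ : IsStandardSpace A τ Ω) (hU : UniqueDiffOn ℝ I)
    (hE : ∀ t ∈ I, IsTraceCondExp A (B t) τ (E t)) (hsmooth : IsSmoothPath I E) {t : ℝ}
    (ht : t ∈ I) (a b : Elem A) :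
    inner ℂ (op (dE I E t a) Ω) (op b Ω) = inner ℂ (op a Ω) (op (dE I E t b) Ω) := by
  have h1 := (hasDerivWithinAt_dE hsmooth ht a Ω).inner ℂ (hasDerivWithinAt_const t I (op b Ω))
  have h2 := (hasDerivWithinAt_const t I (op a Ω)).inner ℂ (hasDerivWithinAt_dE hsmooth ht b Ω)
  rw [inner_zero_right, zero_add] at h1
  rw [inner_zero_left, add_zero] at h2
  exact (hU t ht).eq_deriv I h1 (h2.congr (fun s hs => (hE s hs).isSymm hΩ a b)
    ((hE t ht).isSymm hΩ a b))

theorem dE_star (hτ : IsFaithfulNormalTrace A τ) (hΩ : IsStandardSpace A τ Ω)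
    (hU : UniqueDiffOn ℝ I) (hE : ∀ t ∈ I, IsTraceCondExp A (B t) τ (E t))
    (hsmooth : IsSmoothPath I E) {t : ℝ} (ht : t ∈ I) (a : Elem A) :
    dE I E t (star a) = star (dE I E t a) := by
  apply dE_eq_of_hasDerivWithinAt hτ hΩ hU hsmooth ht
  refine (hasDerivWithinAt_star hτ hΩ (hasDerivWithinAt_dE hsmooth ht a Ω)).congr
    (fun s hs => ?_) ?_
  · rw [(hE s hs).map_star]
  · rw [(hE t ht).map_star]

theorem continuousOn_E (hsmooth : IsSmoothPath I E) (a : Elem A) (ξ : H) :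
    ContinuousOn (fun t => op (E t a) ξ) I :=
  (hsmooth a ξ).continuousOn

/-- The conditional expectations are bounded for the operator norm, locally uniformly in `t`. -/
theorem eventually_norm_E_le (hτ : IsFaithfulNormalTrace A τ) (hΩ : IsStandardSpace A τ Ω)
    (hI : I.OrdConnected) (hE : ∀ t ∈ I, IsTraceCondExp A (B t) τ (E t))
    (hsmooth : IsSmoothPath I E) {t : ℝ} (ht : t ∈ I) (a : Elem A) :
    ∃ K, ∀ᶠ s in 𝓝[I] t, ‖op (E s a)‖ ≤ K := by
  obtain ⟨S, -, hS⟩ := exists_extension hτ hΩ (fun t ht => (hE t ht).isSymm hΩ)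
    (continuousOn_E hsmooth)
  obtain ⟨c, d, hcd, -, -, hn⟩ := exists_Icc_mem_nhdsWithin hI ht ht
  obtain ⟨K, -, hK⟩ := hS c d hcd
  exact ⟨K * ‖op a‖, mem_of_superset hn fun s hs => (hK s hs).2 a⟩

theorem hasDerivWithinAt_E_apply (hτ : IsFaithfulNormalTrace A τ) (hΩ : IsStandardSpace A τ Ω)
    (hI : I.OrdConnected) (hE : ∀ t ∈ I, IsTraceCondExp A (B t) τ (E t))
    (hsmooth : IsSmoothPath I E) {t : ℝ} (ht : t ∈ I) {w : ℝ → Elem A} {w' : Elem A}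
    (hw : HasDerivWithinAt (fun s => op (w s) Ω) (op w' Ω) I t) :
    HasDerivWithinAt (fun s => op (E s (w s)) Ω) (op (dE I E t (w t) + E t w') Ω) I t := by
  obtain ⟨S, hSE, hS⟩ := exists_extension hτ hΩ (fun t ht => (hE t ht).isSymm hΩ)
    (continuousOn_E hsmooth)
  obtain ⟨c, d, hcd, -, -, hn⟩ := exists_Icc_mem_nhdsWithin hI ht ht
  obtain ⟨K, -, hK⟩ := hS c d hcd
  have h := hasDerivWithinAt_apply (S := S) (K := K) (mem_of_superset hn fun s hs => (hK s hs).1) hw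
    ((hasDerivWithinAt_dE hsmooth ht (w t) Ω).congr (fun s hs => hSE s hs _) (hSE t ht _))
    ((continuousOn_E hsmooth w' Ω t ht).congr (fun s hs => hSE s hs _) (hSE t ht _))
  rw [hSE t ht] at h
  exact h.congr (fun s hs => (hSE s hs _).symm) (hSE t ht _).symm

/-- Differentiating `E t (E t a) = E t a` gives `dE ∘ E + E ∘ dE = dE`, and hence `E ∘ dE = 0` on
the range of `E`. -/
theorem E_dE_of_mem (hτ : IsFaithfulNormalTrace A τ) (hΩ : IsStandardSpace A τ Ω)
    (hI : I.OrdConnected) (hU : UniqueDiffOn ℝ I)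
    (hE : ∀ t ∈ I, IsTraceCondExp A (B t) τ (E t))
    (hsmooth : IsSmoothPath I E) {t : ℝ} (ht : t ∈ I) {x : Elem A} (hx : op x ∈ B t) :
    E t (dE I E t x) = 0 := by
  have h := hasDerivWithinAt_E_apply hτ hΩ hI hE hsmooth ht (hasDerivWithinAt_dE hsmooth ht x Ω)
  have h1 := dE_eq_of_hasDerivWithinAt hτ hΩ hU hsmooth ht
    (h.congr (fun s hs => by rw [(hE s hs).fixed _ ((hE s hs).mem x)])
      (by rw [(hE t ht).fixed _ ((hE t ht).mem x)]))
  rw [(hE t ht).fixed x hx] at h1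
  exact left_eq_add.1 h1

/-- On `B t` the map `dE t` is a derivation. The derivative of `E s (E s x * E s y) = E s x * E s y`
at `s = t` contains the additional terms `E (dE x * y)` and `E (x * dE y)`, which vanish by the
bimodule property and `E_dE_of_mem`. -/
theorem dE_mul_of_mem (hτ : IsFaithfulNormalTrace A τ) (hΩ : IsStandardSpace A τ Ω)
    (hI : I.OrdConnected) (hU : UniqueDiffOn ℝ I)
    (hE : ∀ t ∈ I, IsTraceCondExp A (B t) τ (E t))
    (hsmooth : IsSmoothPath I E) {t : ℝ} (ht : t ∈ I) {x y : Elem A} (hx : op x ∈ B t)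
    (hy : op y ∈ B t) : dE I E t (x * y) = dE I E t x * y + x * dE I E t y := by
  have hEt := hE t ht
  obtain ⟨K, hK⟩ := eventually_norm_E_le hτ hΩ hI hE hsmooth ht x
  have h1 := hasDerivWithinAt_mul hτ hΩ hK (hasDerivWithinAt_dE hsmooth ht x Ω)
    (hasDerivWithinAt_dE hsmooth ht y Ω)
  have hfix : ∀ s ∈ I, E s (E s x * E s y) = E s x * E s y := fun s hs => by
    rw [(hE s hs).map_mul_left _ ((hE s hs).mem x), (hE s hs).fixed _ ((hE s hs).mem y)]
  have h2 := hasDerivWithinAt_E_apply hτ hΩ hI hE hsmooth ht h1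
  have h3 := (hU t ht).eq_deriv I (h2.congr (fun s hs => by rw [hfix s hs]) (by rw [hfix t ht])) h1
  have h4 := eq_of_apply_eq hτ hΩ h3
  rwa [hEt.fixed x hx, hEt.fixed y hy, map_add, hEt.map_mul_right _ hy, hEt.map_mul_left _ hx,
    E_dE_of_mem hτ hΩ hI hU hE hsmooth ht hx, E_dE_of_mem hτ hΩ hI hU hE hsmooth ht hy,
    zero_mul, mul_zero, add_zero, add_zero] at h4

/-! ### The transport field -/

theorem transportField_of_mem (hτ : IsFaithfulNormalTrace A τ) (hΩ : IsStandardSpace A τ Ω)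
    (hI : I.OrdConnected) (hU : UniqueDiffOn ℝ I)
    (hE : ∀ t ∈ I, IsTraceCondExp A (B t) τ (E t))
    (hsmooth : IsSmoothPath I E) {t : ℝ} (ht : t ∈ I) {x : Elem A} (hx : op x ∈ B t) :
    transportField I E t x = dE I E t x := by
  rw [transportField, (hE t ht).fixed x hx, E_dE_of_mem hτ hΩ hI hU hE hsmooth ht hx, sub_zero]

theorem transportField_mul (hτ : IsFaithfulNormalTrace A τ) (hΩ : IsStandardSpace A τ Ω)
    (hI : I.OrdConnected) (hU : UniqueDiffOn ℝ I)
    (hE : ∀ t ∈ I, IsTraceCondExp A (B t) τ (E t))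
    (hsmooth : IsSmoothPath I E) {t : ℝ} (ht : t ∈ I) {x y : Elem A} (hx : op x ∈ B t)
    (hy : op y ∈ B t) :
    transportField I E t (x * y) = transportField I E t x * y + x * transportField I E t y := by
  have hxy : op (x * y) ∈ B t := mul_mem (S := VonNeumannAlgebra H) hx hy
  rw [transportField_of_mem hτ hΩ hI hU hE hsmooth ht hxy,
    transportField_of_mem hτ hΩ hI hU hE hsmooth ht hx,
    transportField_of_mem hτ hΩ hI hU hE hsmooth ht hy,
    dE_mul_of_mem hτ hΩ hI hU hE hsmooth ht hx hy]

theorem transportField_star (hτ : IsFaithfulNormalTrace A τ) (hΩ : IsStandardSpace A τ Ω)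
    (hU : UniqueDiffOn ℝ I) (hE : ∀ t ∈ I, IsTraceCondExp A (B t) τ (E t))
    (hsmooth : IsSmoothPath I E) {t : ℝ} (ht : t ∈ I) (x : Elem A) :
    transportField I E t (star x) = star (transportField I E t x) := by
  rw [transportField, transportField, star_sub, (hE t ht).map_star,
    dE_star hτ hΩ hU hE hsmooth ht, dE_star hτ hΩ hU hE hsmooth ht, (hE t ht).map_star]

/-- The relation `[dE, E] E = dE E = dE + E [dE, E]` that makes `E t (α t)` a solution of the
transport equation whenever `α` is one. -/
theorem transportField_E (hτ : IsFaithfulNormalTrace A τ) (hΩ : IsStandardSpace A τ Ω)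
    (hI : I.OrdConnected) (hU : UniqueDiffOn ℝ I)
    (hE : ∀ t ∈ I, IsTraceCondExp A (B t) τ (E t))
    (hsmooth : IsSmoothPath I E) {t : ℝ} (ht : t ∈ I) (x : Elem A) :
    transportField I E t (E t x) = dE I E t x + E t (transportField I E t x) := by
  have hx := (hE t ht).mem x
  have h := hasDerivWithinAt_E_apply hτ hΩ hI hE hsmooth ht (hasDerivWithinAt_dE hsmooth ht x Ω)
  have h1 := dE_eq_of_hasDerivWithinAt hτ hΩ hU hsmooth ht
    (h.congr (fun s hs => by rw [(hE s hs).fixed _ ((hE s hs).mem x)])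
      (by rw [(hE t ht).fixed _ ((hE t ht).mem x)]))
  rw [transportField_of_mem hτ hΩ hI hU hE hsmooth ht hx, transportField, map_sub,
    E_dE_of_mem hτ hΩ hI hU hE hsmooth ht hx, (hE t ht).fixed _ ((hE t ht).mem (dE I E t x)),
    zero_sub, ← sub_eq_add_neg]
  exact eq_sub_of_add_eq h1.symm

/-- The transport field extends to a strongly continuous, locally bounded family of skew-adjoint
operators on `H`, and it is locally bounded for the operator norm of `A`. -/
theorem exists_generator (hτ : IsFaithfulNormalTrace A τ) (hΩ : IsStandardSpace A τ Ω)
    (hI : I.OrdConnected) (hU : UniqueDiffOn ℝ I)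
    (hE : ∀ t ∈ I, IsTraceCondExp A (B t) τ (E t)) (hsmooth : IsSmoothPath I E) :
    ∃ C : ℝ → H →L[ℂ] H,
      (∀ t ∈ I, ∀ a : Elem A, C t (op a Ω) = op (transportField I E t a) Ω) ∧
      (∀ u : ℝ → H, ContinuousOn u I → ContinuousOn (fun t => C t (u t)) I) ∧
      (∀ c d, Icc c d ⊆ I → ∃ K : ℝ, 0 ≤ K ∧ ∀ t ∈ Icc c d, ‖C t‖ ≤ K ∧
        ∀ a, ‖op (transportField I E t a)‖ ≤ K * ‖op a‖) ∧
      ∀ t ∈ I, ∀ v, (inner ℂ v (C t v)).re = 0 := by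
  obtain ⟨D₀, hD₀⟩ := exists_dE_linear hτ hΩ hU hsmooth
  obtain ⟨P, hPE, hP⟩ := exists_extension hτ hΩ (fun t ht => (hE t ht).isSymm hΩ)
    (continuousOn_E hsmooth)
  obtain ⟨D, hDE, hD⟩ := exists_extension hτ hΩ (I := I) (T := D₀)
    (fun t ht a b => by
      rw [hD₀ t ht, hD₀ t ht]
      exact inner_dE hΩ hU hE hsmooth ht a b)
    (fun a ξ => (continuousOn_dE hU hsmooth a ξ).congr fun t ht => by rw [hD₀ t ht])
  have hDE' : ∀ t ∈ I, ∀ a : Elem A, D t (op a Ω) = op (dE I E t a) Ω := fun t ht a => by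
    rw [hDE t ht, hD₀ t ht]
  have hPc : ∀ u : ℝ → H, ContinuousOn u I → ContinuousOn (fun t => P t (u t)) I := fun u hu =>
    continuousOn_apply_of_dense hΩ.dense hI
      (fun c d h => (hP c d h).imp fun K hK t ht => (hK.2 t ht).1)
      (fun a => (continuousOn_E hsmooth a Ω).congr fun t ht => hPE t ht a) hu
  have hDc : ∀ u : ℝ → H, ContinuousOn u I → ContinuousOn (fun t => D t (u t)) I := fun u hu =>
    continuousOn_apply_of_dense hΩ.dense hI
      (fun c d h => (hD c d h).imp fun K hK t ht => (hK.2 t ht).1)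
      (fun a => (continuousOn_dE hU hsmooth a Ω).congr fun t ht => hDE' t ht a) hu
  have hsymm : ∀ S : H →L[ℂ] H, (∀ a b : Elem A,
      inner ℂ (S (op a Ω)) (op b Ω) = inner ℂ (op a Ω) (S (op b Ω))) →
      ∀ v w, inner ℂ (S v) w = inner ℂ v (S w) := by
    intro S hS v w
    refine hΩ.dense.induction_on₂ (p := fun v w => inner ℂ (S v) w = inner ℂ v (S w))
      ?_ hS v w
    exact isClosed_eq (by fun_prop) (by fun_prop)
  refine ⟨fun t => D t * P t - P t * D t, fun t ht a => ?_, fun u hu => ?_, fun c d h => ?_,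
    fun t ht v => ?_⟩
  · change D t (P t (op a Ω)) - P t (D t (op a Ω)) = _
    rw [hPE t ht, hDE' t ht, hDE' t ht, hPE t ht]
    rfl
  · exact (hDc _ (hPc u hu)).sub (hPc _ (hDc u hu))
  · obtain ⟨K, hK, hKP⟩ := hP c d h
    obtain ⟨L, hL, hLD⟩ := hD c d h
    refine ⟨L * K + K * L, by positivity, fun t ht => ⟨?_, fun a => ?_⟩⟩
    · refine (norm_sub_le _ _).trans (add_le_add ?_ ?_)
      · exact (norm_mul_le _ _).trans
          (mul_le_mul (hLD t ht).1 (hKP t ht).1 (norm_nonneg _) hL)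
      · exact (norm_mul_le _ _).trans
          (mul_le_mul (hKP t ht).1 (hLD t ht).1 (norm_nonneg _) hK)
    · have hL' : ∀ b, ‖op (dE I E t b)‖ ≤ L * ‖op b‖ := fun b => by
        rw [← hD₀ t (h ht)]
        exact (hLD t ht).2 b
      have hK' := (hKP t ht).2
      calc ‖op (transportField I E t a)‖ ≤ ‖op (dE I E t (E t a))‖ + ‖op (E t (dE I E t a))‖ :=
            norm_sub_le _ _
        _ ≤ L * (K * ‖op a‖) + K * (L * ‖op a‖) :=
            add_le_add ((hL' _).trans (by gcongr; exact hK' a))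
              ((hK' _).trans (by gcongr; exact hL' a))
        _ = (L * K + K * L) * ‖op a‖ := by ring
  · have hDs := hsymm (D t) fun a b => by
      rw [hDE' t ht, hDE' t ht]
      exact inner_dE hΩ hU hE hsmooth ht a b
    have hPs := hsymm (P t) fun a b => by
      rw [hPE t ht, hPE t ht]
      exact (hE t ht).isSymm hΩ a b
    change (inner ℂ v (D t (P t v) - P t (D t v))).re = 0
    rw [inner_sub_right, ← hDs, ← hPs, Complex.sub_re, sub_eq_zero,
      ← inner_conj_symm, Complex.conj_re]

end Derivative

/-! ### Existence of solutions -/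

/-- Integration preserves the closed convex cone `ballCone`. -/
theorem integral_mem_ballCone (hτ : IsFaithfulNormalTrace A τ) (hΩ : IsStandardSpace A τ Ω)
    {s t : ℝ} {g : ℝ → ℝ} {f : ℝ → H} (hg : ContinuousOn g (uIcc s t))
    (hf : ContinuousOn f (uIcc s t)) (h : ∀ x ∈ uIcc s t, (g x, f x) ∈ ballCone A Ω) :
    (∫ x in uIoc s t, g x, ∫ x in s..t, f x) ∈ ballCone A Ω := by
  rcases eq_or_ne s t with rfl | hst
  · have h0 := ballCone_smul (h s left_mem_uIcc) 0
    simpa using h0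
  have hvol : volume (uIoc s t) = ENNReal.ofReal |t - s| := Real.volume_uIoc
  have hpos : 0 < |t - s| := abs_pos.2 (sub_ne_zero.2 hst.symm)
  have hgi : IntegrableOn g (uIoc s t) := (hg.intervalIntegrable).def'
  have hfi : IntegrableOn f (uIoc s t) := (hf.intervalIntegrable).def'
  have hav := (convex_ballCone (A := A) (Ω := Ω)).set_average_mem (μ := volume) (t := uIoc s t)
    (f := fun x => (g x, f x)) (isClosed_ballCone hτ hΩ)
    (by rw [hvol]; simpa using hpos) (by rw [hvol]; exact ENNReal.ofReal_ne_top)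
    (ae_restrict_of_forall_mem measurableSet_uIoc fun x hx => h x (uIoc_subset_uIcc hx))
    (hgi.prodMk hfi)
  rw [setAverage_eq, integral_pair hgi hfi, measureReal_def, hvol,
    ENNReal.toReal_ofReal hpos.le] at hav
  have h2 := ballCone_smul hav ((if s ≤ t then 1 else -1) * |t - s|)
  have habs : abs ((if s ≤ t then (1 : ℝ) else -1) * |t - s|) = |t - s| := by
    rw [abs_mul, abs_abs]
    split_ifs <;> simp
  rw [habs] at h2
  rw [intervalIntegral.intervalIntegral_eq_integral_uIoc]
  convert h2 using 2
  · change _ = |t - s| * (|t - s|⁻¹ * _)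
    rw [mul_inv_cancel_left₀ hpos.ne']
  · change _ = (_ * |t - s|) • (|t - s|⁻¹ • _)
    rw [smul_smul, mul_assoc, mul_inv_cancel₀ hpos.ne', mul_one]

/-- Picard iteration for `v' = C t v`. The operator norm of the `n`-th iterate, an element of
`A`, is controlled along with its norm in `H`, so that the solution stays in `A`. -/
theorem exists_solution_of_generator (hτ : IsFaithfulNormalTrace A τ)
    (hΩ : IsStandardSpace A τ Ω) {I : Set ℝ} (hI : I.OrdConnected) {C : ℝ → H →L[ℂ] H}
    (hCc : ∀ u : ℝ → H, ContinuousOn u I → ContinuousOn (fun t => C t (u t)) I)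
    (hCb : ∀ c d, Icc c d ⊆ I → ∃ K : ℝ, 0 ≤ K ∧ ∀ t ∈ Icc c d, ‖C t‖ ≤ K ∧
      ∀ r v, (r, v) ∈ ballCone A Ω → (K * r, C t v) ∈ ballCone A Ω)
    {s : ℝ} (hs : s ∈ I) (a : Elem A) :
    ∃ α : ℝ → Elem A, α s = a ∧
      (∀ t ∈ I, HasDerivWithinAt (fun r => op (α r) Ω) (C t (op (α t) Ω)) I t) ∧
      ∀ t ∈ I, ∃ M, ∀ᶠ r in 𝓝[I] t, ‖op (α r)‖ ≤ M := by
  let u : ℕ → ℝ → H := fun n => Nat.rec (fun _ => op a Ω) (fun _ v t => ∫ x in s..t, C x (v x)) n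
  have hu_cont : ∀ n, ContinuousOn (u n) I := by
    intro n
    induction n with
    | zero => exact continuousOn_const
    | succ n ih => exact fun t ht =>
        (hasDerivWithinAt_integral hI (hCc _ ih) hs ht).continuousWithinAt
  -- the estimate of the iterates on a closed interval `[c, d]` containing `s`
  have hu_mem : ∀ c d, Icc c d ⊆ I → s ∈ Icc c d → ∃ K : ℝ, 0 ≤ K ∧ (∀ t ∈ Icc c d, ‖C t‖ ≤ K) ∧
      ∀ n, ∀ t ∈ Icc c d,
        (‖op a‖ * ((K * (d - c)) ^ n / n.factorial), u n t) ∈ ballCone A Ω := by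
    intro c d hcd hscd
    obtain ⟨K, hK, hKC⟩ := hCb c d hcd
    refine ⟨K, hK, fun t ht => (hKC t ht).1, ?_⟩
    have key : ∀ n : ℕ, ∀ t ∈ Icc c d,
        (‖op a‖ * (K ^ n * |t - s| ^ n / n.factorial), u n t) ∈ ballCone A Ω := by
      intro n
      induction n with
      | zero => exact fun t _ => ⟨a, rfl, by simp⟩
      | succ n ih =>
        intro t ht
        have hsub : uIcc s t ⊆ Icc c d := ordConnected_Icc.uIcc_subset hscd ht
        have h := integral_mem_ballCone hτ hΩ (s := s) (t := t)
          (g := fun x => (K * ‖op a‖ * K ^ n / n.factorial) * |x - s| ^ n)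
          (f := fun x => C x (u n x)) (by fun_prop)
          ((hCc _ (hu_cont n)).mono (hsub.trans hcd)) fun x hx => by
            convert (hKC x (hsub hx)).2 _ _ (ih x (hsub hx)) using 2
            ring
        rw [integral_const_mul, integral_pow_abs_sub_uIoc] at h
        convert h using 2
        rw [Nat.factorial_succ]
        push_cast
        field_simp
        ring
    intro n t ht
    refine ballCone_mono (key n t ht) ?_
    rw [mul_pow]
    have : |t - s| ≤ d - c := by
      rw [abs_le]
      constructor <;> linarith [ht.1, ht.2, hscd.1, hscd.2]
    gcongr
  have hsummable : ∀ x : ℝ, Summable fun n : ℕ => ‖op a‖ * (x ^ n / n.factorial) := fun x =>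
    (Real.summable_pow_div_factorial x).mul_left _
  let ψ : ℝ → H := fun t => ∑' n, u n t
  have hsum : ∀ t ∈ I, HasSum (fun n => u n t) (ψ t) := by
    intro t ht
    obtain ⟨c, d, hcd, hscd, htcd, -⟩ := exists_Icc_mem_nhdsWithin hI hs ht
    obtain ⟨K, -, -, hK⟩ := hu_mem c d hcd hscd
    exact (Summable.of_norm_bounded ((hsummable _).mul_right ‖Ω‖)
      fun n => norm_le_of_mem_ballCone (hK n t htcd)).hasSum
  have hψ_cont : ContinuousOn ψ I := by
    intro t ht
    obtain ⟨c, d, hcd, hscd, htcd, hn⟩ := exists_Icc_mem_nhdsWithin hI hs ht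
    obtain ⟨K, -, -, hK⟩ := hu_mem c d hcd hscd
    have h : ContinuousOn ψ (Icc c d) := continuousOn_tsum (fun n => (hu_cont n).mono hcd)
      ((hsummable _).mul_right ‖Ω‖) fun n x hx => norm_le_of_mem_ballCone (hK n x hx)
    exact (h t htcd).mono_of_mem_nhdsWithin hn
  have hψ_eq : ∀ t ∈ I, ψ t = op a Ω + ∫ x in s..t, C x (ψ x) := by
    intro t ht
    obtain ⟨c, d, hcd, hscd, htcd, -⟩ := exists_Icc_mem_nhdsWithin hI hs ht
    obtain ⟨K, hK0, hKC, hK⟩ := hu_mem c d hcd hscd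
    have hsub : uIoc s t ⊆ Icc c d :=
      uIoc_subset_uIcc.trans (ordConnected_Icc.uIcc_subset hscd htcd)
    have hsub' : uIcc s t ⊆ I := (ordConnected_Icc.uIcc_subset hscd htcd).trans hcd
    have h1 : HasSum (fun n => u (n + 1) t) (∫ x in s..t, C x (ψ x)) := by
      refine intervalIntegral.hasSum_integral_of_dominated_convergence
        (F := fun n x => C x (u n x))
        (fun n _ => K * (‖op a‖ * ((K * (d - c)) ^ n / n.factorial) * ‖Ω‖)) (fun n => ?_)
        (fun n => ae_of_all _ fun x hx => ?_) (ae_of_all _ fun x _ => ?_) ?_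
        (ae_of_all _ fun x hx => ?_)
      · exact (((hCc _ (hu_cont n)).mono hsub').intervalIntegrable.def').aestronglyMeasurable
      · exact ((C x).le_opNorm _).trans (mul_le_mul (hKC x (hsub hx))
          (norm_le_of_mem_ballCone (hK n x (hsub hx))) (norm_nonneg _) hK0)
      · exact ((hsummable _).mul_right _).mul_left _
      · exact intervalIntegrable_const
      · exact (C x).hasSum (hsum x (hcd (hsub hx)))
    have h2 : HasSum (fun n => u (n + 1) t) (ψ t - op a Ω) := by
      have := (hasSum_nat_add_iff' 1).2 (hsum t ht)
      simpa [u] using this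
    rw [h1.unique h2]
    abel
  have hψ_mem : ∀ t ∈ I, ∃ M, ∀ᶠ r in 𝓝[I] t, (M, ψ r) ∈ ballCone A Ω := by
    intro t ht
    obtain ⟨c, d, hcd, hscd, -, hn⟩ := exists_Icc_mem_nhdsWithin hI hs ht
    obtain ⟨K, -, -, hK⟩ := hu_mem c d hcd hscd
    refine ⟨∑' n : ℕ, ‖op a‖ * ((K * (d - c)) ^ n / n.factorial),
      mem_of_superset hn fun r hr => ?_⟩
    have h := ((hsummable (K * (d - c))).hasSum.prodMk (hsum r (hcd hr))).tendsto_sum_nat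
    refine (isClosed_ballCone hτ hΩ).mem_of_tendsto h (Eventually.of_forall fun m => ?_)
    induction m with
    | zero => exact ⟨0, rfl, by simp⟩
    | succ m ih =>
      rw [Finset.sum_range_succ]
      exact ballCone_add ih (hK m r hr)
  have hψ_A : ∀ t, ∃ x : Elem A, t ∈ I → op x Ω = ψ t := by
    intro t
    by_cases ht : t ∈ I
    · obtain ⟨M, hM⟩ := hψ_mem t ht
      obtain ⟨x, hx, -⟩ := hM.self_of_nhdsWithin ht
      exact ⟨x, fun _ => hx⟩
    · exact ⟨0, fun h => absurd h ht⟩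
  choose α hα using hψ_A
  refine ⟨α, ?_, fun t ht => ?_, fun t ht => ?_⟩
  · apply eq_of_apply_eq hτ hΩ
    rw [hα s hs, hψ_eq s hs, intervalIntegral.integral_same, add_zero]
  · rw [hα t ht]
    exact ((hasDerivWithinAt_integral hI (hCc ψ hψ_cont) hs ht).const_add (op a Ω)).congr
      (fun r hr => (hα r hr).trans (hψ_eq r hr)) ((hα t ht).trans (hψ_eq t ht))
  · obtain ⟨M, hM⟩ := hψ_mem t ht
    refine ⟨M, ?_⟩
    filter_upwards [hM, self_mem_nhdsWithin] with r hr hrI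
    obtain ⟨x, hx, hxM⟩ := hr
    rwa [eq_of_apply_eq hτ hΩ ((hα r hrI).trans hx.symm)]

/-! ### Uniqueness of weak solutions -/

/-- A weak solution of `γ' = C t γ` with `C t` skew-adjoint has constant norm. Being locally
bounded by the uniform boundedness principle, it is locally Lipschitz, so that the error term in
`‖γ r‖² = 2 Re ⟨γ t, γ r⟩ - ‖γ t‖² + ‖γ r - γ t‖²` is quadratic in `r - t`. -/
theorem eq_zero_of_weak_solution {I : Set ℝ} (hI : I.OrdConnected) {C : ℝ → H →L[ℂ] H}
    (hCb : ∀ c d, Icc c d ⊆ I → ∃ K : ℝ, 0 ≤ K ∧ ∀ t ∈ Icc c d, ‖C t‖ ≤ K)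
    (hskew : ∀ t ∈ I, ∀ v, (inner ℂ v (C t v)).re = 0) {γ : ℝ → H}
    (hγ : ∀ ξ : H, ∀ t ∈ I,
      HasDerivWithinAt (fun r => inner ℂ ξ (γ r)) (inner ℂ ξ (C t (γ t))) I t)
    {s : ℝ} (hs : s ∈ I) (h0 : γ s = 0) {t : ℝ} (ht : t ∈ I) : γ t = 0 := by
  obtain ⟨c, d, hcd, hscd, htcd, -⟩ := exists_Icc_mem_nhdsWithin hI hs ht
  obtain ⟨K, hK0, hK⟩ := hCb c d hcd
  have hγJ : ∀ ξ : H, ∀ r ∈ Icc c d,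
      HasDerivWithinAt (fun r => inner ℂ ξ (γ r)) (inner ℂ ξ (C r (γ r))) (Icc c d) r :=
    fun ξ r hr => (hγ ξ r (hcd hr)).mono hcd
  obtain ⟨M, hM⟩ : ∃ M, ∀ r : Icc c d, ‖innerSL ℂ (γ r)‖ ≤ M := banach_steinhaus fun ξ => by
    have hc : ContinuousOn (fun r => inner ℂ ξ (γ r)) (Icc c d) := fun r hr =>
      (hγJ ξ r hr).continuousWithinAt
    obtain ⟨M, hM⟩ := (isCompact_Icc.image_of_continuousOn hc).isBounded.exists_norm_le
    refine ⟨M, fun r => ?_⟩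
    rw [innerSL_apply_apply, norm_inner_symm]
    exact hM _ (mem_image_of_mem _ r.2)
  have hM' : ∀ r ∈ Icc c d, ‖γ r‖ ≤ M := fun r hr => by
    rw [← innerSL_apply_norm (𝕜 := ℂ)]
    exact hM ⟨r, hr⟩
  have hlip : ∀ r ∈ Icc c d, ∀ q ∈ Icc c d, ‖γ q - γ r‖ ≤ K * M * |q - r| := by
    intro r hr q hq
    set ξ := γ q - γ r with hξ
    have h := (convex_Icc c d).norm_image_sub_le_of_norm_hasDerivWithin_le (C := ‖ξ‖ * (K * M))
      (hγJ ξ) (fun x hx => (norm_inner_le_norm _ _).trans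
        (mul_le_mul_of_nonneg_left (((C x).le_opNorm _).trans
          (mul_le_mul (hK x hx) (hM' x hx) (norm_nonneg _) hK0)) (norm_nonneg _))) hr hq
    rw [← inner_sub_right, ← hξ, inner_self_eq_norm_sq_to_K, norm_pow, Real.norm_eq_abs,
      RCLike.norm_ofReal, abs_norm, sq, mul_assoc] at h
    rcases (norm_nonneg ξ).eq_or_lt with h0 | h0
    · rw [← h0]
      exact mul_nonneg (mul_nonneg hK0 ((norm_nonneg _).trans (hM' r hr))) (abs_nonneg _)
    · exact le_of_mul_le_mul_left h h0
  have hderiv : ∀ r ∈ Icc c d, HasDerivWithinAt (fun q => ‖γ q‖ ^ 2) 0 (Icc c d) r := by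
    intro r hr
    have h1 := (Complex.reCLM.hasFDerivAt.comp_hasDerivWithinAt r (hγJ (γ r) r hr)).const_mul 2
    have h2 : HasDerivWithinAt (fun q => ‖γ q - γ r‖ ^ 2) 0 (Icc c d) r := by
      rw [hasDerivWithinAt_iff_isLittleO]
      have hO : (fun q => ‖γ q - γ r‖ ^ 2) =O[𝓝[Icc c d] r] fun q => ‖q - r‖ ^ 2 := by
        refine Asymptotics.IsBigO.of_bound ((K * M) ^ 2)
          (mem_of_superset self_mem_nhdsWithin fun q hq => ?_)
        change ‖‖γ q - γ r‖ ^ 2‖ ≤ (K * M) ^ 2 * ‖‖q - r‖ ^ 2‖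
        rw [Real.norm_of_nonneg (sq_nonneg _), Real.norm_of_nonneg (sq_nonneg _), ← mul_pow]
        exact pow_le_pow_left₀ (norm_nonneg _) (hlip r hr q hq) 2
      have ho := hO.trans_isLittleO
        ((Asymptotics.isLittleO_norm_pow_id one_lt_two).comp_tendsto
          (tendsto_sub_nhds_zero_iff.2 (tendsto_nhdsWithin_of_tendsto_nhds tendsto_id)))
      simpa [Function.comp_def] using ho
    have h3 := (h1.sub_const (‖γ r‖ ^ 2)).add h2
    have hz : 2 * Complex.reCLM (inner ℂ (γ r) (C r (γ r))) + 0 = 0 := by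
      rw [Complex.reCLM_apply, hskew r (hcd hr), mul_zero, add_zero]
    rw [hz] at h3
    have hid : ∀ q, ‖γ q‖ ^ 2 = 2 * (inner ℂ (γ r) (γ q)).re - ‖γ r‖ ^ 2 + ‖γ q - γ r‖ ^ 2 := by
      intro q
      have := norm_sub_sq (𝕜 := ℂ) (γ q) (γ r)
      rw [this, ← inner_conj_symm (γ q) (γ r)]
      simp only [RCLike.conj_re, RCLike.re_to_complex]
      ring
    exact h3.congr (fun q _ => hid q) (hid r)
  have h := (convex_Icc c d).norm_image_sub_le_of_norm_hasDerivWithin_le (C := 0) hderiv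
    (fun x _ => by simp) hscd htcd
  rw [h0, norm_zero, zero_mul] at h
  simpa using h

/-! ### Propagators -/

section Propagator

variable {I : Set ℝ} {B : ℝ → VonNeumannAlgebra H} {E : ℝ → Elem A →ₗ[ℂ] Elem A}

/-- A strong solution of the transport equation: `t ↦ α t Ω` is differentiable for the norm of
`H`, and `α` is locally bounded for the operator norm. -/
structure IsStrongSolution (Ω : H) (I : Set ℝ) (E : ℝ → Elem A →ₗ[ℂ] Elem A)
    (α : ℝ → Elem A) : Prop where
  hasDeriv : ∀ t ∈ I, HasDerivWithinAt (fun s => op (α s) Ω)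
    (op (transportField I E t (α t)) Ω) I t
  bounded : ∀ t ∈ I, ∃ M, ∀ᶠ s in 𝓝[I] t, ‖op (α s)‖ ≤ M

theorem isWeakSolution_of_hasDerivWithinAt {α : ℝ → Elem A}
    (h : ∀ t ∈ I, HasDerivWithinAt (fun s => op (α s) Ω)
      (op (transportField I E t (α t)) Ω) I t) : IsWeakSolution Ω I E α := fun ξ t ht =>
  ((innerSL ℂ ξ).restrictScalars ℝ).hasFDerivAt.comp_hasDerivWithinAt t (h t ht)

theorem IsStrongSolution.isWeakSolution {α : ℝ → Elem A} (h : IsStrongSolution Ω I E α) :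
    IsWeakSolution Ω I E α :=
  isWeakSolution_of_hasDerivWithinAt h.hasDeriv

theorem exists_isStrongSolution (hτ : IsFaithfulNormalTrace A τ) (hΩ : IsStandardSpace A τ Ω)
    (hI : I.OrdConnected) (hU : UniqueDiffOn ℝ I)
    (hE : ∀ t ∈ I, IsTraceCondExp A (B t) τ (E t)) (hsmooth : IsSmoothPath I E) {s : ℝ}
    (hs : s ∈ I) (a : Elem A) : ∃ α, IsStrongSolution Ω I E α ∧ α s = a := by
  obtain ⟨C, hC, hCc, hCb, -⟩ := exists_generator hτ hΩ hI hU hE hsmooth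
  obtain ⟨α, hα, hd, hb⟩ := exists_solution_of_generator hτ hΩ hI hCc (fun c d h => by
    obtain ⟨K, hK, hKC⟩ := hCb c d h
    refine ⟨K, hK, fun t ht => ⟨(hKC t ht).1, fun r v hv => ?_⟩⟩
    obtain ⟨x, rfl, hx⟩ := hv
    exact ⟨transportField I E t x, (hC t (h ht) x).symm,
      ((hKC t ht).2 x).trans (mul_le_mul_of_nonneg_left hx hK)⟩) hs a
  exact ⟨α, ⟨fun t ht => (hd t ht).congr_deriv (hC t ht (α t)), hb⟩, hα⟩

theorem IsWeakSolution.eq_of_eq (hτ : IsFaithfulNormalTrace A τ) (hΩ : IsStandardSpace A τ Ω)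
    (hI : I.OrdConnected) (hU : UniqueDiffOn ℝ I)
    (hE : ∀ t ∈ I, IsTraceCondExp A (B t) τ (E t)) (hsmooth : IsSmoothPath I E)
    {α β : ℝ → Elem A} (hα : IsWeakSolution Ω I E α) (hβ : IsWeakSolution Ω I E β) {s t : ℝ}
    (hs : s ∈ I) (h : α s = β s) (ht : t ∈ I) : α t = β t := by
  obtain ⟨C, hC, -, hCb, hskew⟩ := exists_generator hτ hΩ hI hU hE hsmooth
  refine eq_of_apply_eq hτ hΩ (sub_eq_zero.1 ?_)
  refine eq_zero_of_weak_solution hI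
    (fun c d h => (hCb c d h).imp fun K hK => ⟨hK.1, fun t ht => (hK.2 t ht).1⟩) hskew
    (γ := fun r => op (α r) Ω - op (β r) Ω) (fun ξ r hr => ?_) hs (by simp [h]) ht
  simp only [inner_sub_right, map_sub, hC r hr]
  exact (hα ξ r hr).sub (hβ ξ r hr)

theorem IsStrongSolution.add (hτ : IsFaithfulNormalTrace A τ) (hΩ : IsStandardSpace A τ Ω)
    (hI : I.OrdConnected) (hU : UniqueDiffOn ℝ I)
    (hE : ∀ t ∈ I, IsTraceCondExp A (B t) τ (E t)) (hsmooth : IsSmoothPath I E)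
    {α β : ℝ → Elem A} (hα : IsStrongSolution Ω I E α) (hβ : IsStrongSolution Ω I E β) :
    IsWeakSolution Ω I E fun t => α t + β t := by
  obtain ⟨C, hC, -⟩ := exists_generator hτ hΩ hI hU hE hsmooth
  refine isWeakSolution_of_hasDerivWithinAt fun t ht => ?_
  refine ((hα.hasDeriv t ht).add (hβ.hasDeriv t ht)).congr_deriv ?_
  rw [← hC t ht, ← hC t ht, ← hC t ht, ← map_add]
  rfl

theorem IsStrongSolution.smul (hτ : IsFaithfulNormalTrace A τ) (hΩ : IsStandardSpace A τ Ω)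
    (hI : I.OrdConnected) (hU : UniqueDiffOn ℝ I)
    (hE : ∀ t ∈ I, IsTraceCondExp A (B t) τ (E t)) (hsmooth : IsSmoothPath I E)
    {α : ℝ → Elem A} (hα : IsStrongSolution Ω I E α) (k : ℂ) :
    IsWeakSolution Ω I E fun t => k • α t := by
  obtain ⟨C, hC, -⟩ := exists_generator hτ hΩ hI hU hE hsmooth
  refine isWeakSolution_of_hasDerivWithinAt fun t ht => ?_
  refine ((hα.hasDeriv t ht).const_smul k).congr_deriv ?_
  rw [← hC t ht, ← hC t ht, ← map_smul]
  rfl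

theorem IsStrongSolution.star (hτ : IsFaithfulNormalTrace A τ) (hΩ : IsStandardSpace A τ Ω)
    (hU : UniqueDiffOn ℝ I)
    (hE : ∀ t ∈ I, IsTraceCondExp A (B t) τ (E t)) (hsmooth : IsSmoothPath I E)
    {α : ℝ → Elem A} (hα : IsStrongSolution Ω I E α) :
    IsWeakSolution Ω I E fun t => Star.star (α t) := by
  refine isWeakSolution_of_hasDerivWithinAt fun t ht => ?_
  rw [transportField_star hτ hΩ hU hE hsmooth ht]
  exact hasDerivWithinAt_star hτ hΩ (hα.hasDeriv t ht)

/-- A solution starting in `B s` stays in the algebras `B t`: the curve `E t (α t)` solves the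
transport equation with the same initial value. -/
theorem IsStrongSolution.mem (hτ : IsFaithfulNormalTrace A τ) (hΩ : IsStandardSpace A τ Ω)
    (hI : I.OrdConnected) (hU : UniqueDiffOn ℝ I)
    (hE : ∀ t ∈ I, IsTraceCondExp A (B t) τ (E t)) (hsmooth : IsSmoothPath I E)
    {α : ℝ → Elem A} (hα : IsStrongSolution Ω I E α) {s t : ℝ} (hs : s ∈ I)
    (h : op (α s) ∈ B s) (ht : t ∈ I) : op (α t) ∈ B t := by
  have hEα : IsWeakSolution Ω I E fun t => E t (α t) := by
    refine isWeakSolution_of_hasDerivWithinAt fun t ht => ?_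
    rw [transportField_E hτ hΩ hI hU hE hsmooth ht]
    exact hasDerivWithinAt_E_apply hτ hΩ hI hE hsmooth ht (hα.hasDeriv t ht)
  rw [← hEα.eq_of_eq hτ hΩ hI hU hE hsmooth hα.isWeakSolution hs ((hE s hs).fixed _ h) ht]
  exact (hE t ht).mem _

theorem IsStrongSolution.mul (hτ : IsFaithfulNormalTrace A τ) (hΩ : IsStandardSpace A τ Ω)
    (hI : I.OrdConnected) (hU : UniqueDiffOn ℝ I)
    (hE : ∀ t ∈ I, IsTraceCondExp A (B t) τ (E t)) (hsmooth : IsSmoothPath I E)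
    {α β : ℝ → Elem A} (hα : IsStrongSolution Ω I E α) (hβ : IsStrongSolution Ω I E β)
    (hαB : ∀ t ∈ I, op (α t) ∈ B t) (hβB : ∀ t ∈ I, op (β t) ∈ B t) :
    IsWeakSolution Ω I E fun t => α t * β t := by
  refine isWeakSolution_of_hasDerivWithinAt fun t ht => ?_
  obtain ⟨M, hM⟩ := hα.bounded t ht
  rw [transportField_mul hτ hΩ hI hU hE hsmooth ht (hαB t ht) (hβB t ht)]
  exact hasDerivWithinAt_mul hτ hΩ hM (hα.hasDeriv t ht) (hβ.hasDeriv t ht)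

theorem propagator_spec {α : ℝ → Elem A} {s : ℝ} {a : Elem A} (hα : IsWeakSolution Ω I E α)
    (h : α s = a) : IsWeakSolution Ω I E (fun t => propagator Ω I E t s a) ∧
      propagator Ω I E s s a = a := by
  have hex : ∃ α : ℝ → Elem A, IsWeakSolution Ω I E α ∧ α s = a := ⟨α, hα, h⟩
  have he : ∀ t, propagator Ω I E t s a = hex.choose t := fun t => by rw [propagator, dif_pos hex]
  simp only [he]
  exact hex.choose_spec

theorem propagator_eq (hτ : IsFaithfulNormalTrace A τ) (hΩ : IsStandardSpace A τ Ω)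
    (hI : I.OrdConnected) (hU : UniqueDiffOn ℝ I)
    (hE : ∀ t ∈ I, IsTraceCondExp A (B t) τ (E t)) (hsmooth : IsSmoothPath I E)
    {α : ℝ → Elem A} {s t : ℝ} {a : Elem A} (hα : IsWeakSolution Ω I E α) (hs : s ∈ I)
    (h : α s = a) (ht : t ∈ I) : α t = propagator Ω I E t s a := by
  obtain ⟨h1, h2⟩ := propagator_spec hα h
  exact hα.eq_of_eq hτ hΩ hI hU hE hsmooth h1 hs (h.trans h2.symm) ht

/-- The propagator restricts to a `*`-isomorphism of `B s` onto `B t`; it is onto because the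
transport equation can be solved backwards from time `t`. -/
theorem exists_starAlgEquiv (hτ : IsFaithfulNormalTrace A τ) (hΩ : IsStandardSpace A τ Ω)
    (hI : I.OrdConnected) (hU : UniqueDiffOn ℝ I) (hBA : ∀ t ∈ I, ∀ x ∈ B t, x ∈ A)
    (hE : ∀ t ∈ I, IsTraceCondExp A (B t) τ (E t)) (hsmooth : IsSmoothPath I E) {s t : ℝ}
    (hs : s ∈ I) (ht : t ∈ I) :
    ∃ θ : Elem (B s) ≃⋆ₐ[ℂ] Elem (B t), ∀ b : Elem (B s),
      (θ b : H →L[ℂ] H) =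
        (propagator Ω I E t s ⟨(b : H →L[ℂ] H), hBA s hs _ b.2⟩ : H →L[ℂ] H) := by
  have hsol : ∀ b : Elem (B s), ∃ α, IsStrongSolution Ω I E α ∧
      α s = ⟨(b : H →L[ℂ] H), hBA s hs _ b.2⟩ := fun b =>
    exists_isStrongSolution hτ hΩ hI hU hE hsmooth hs _
  choose α hα hαs using hsol
  have hαB : ∀ b, ∀ r ∈ I, op (α b r) ∈ B r := fun b r hr =>
    (hα b).mem hτ hΩ hI hU hE hsmooth hs (by rw [hαs]; exact b.2) hr
  have huniq : ∀ {b : Elem (B s)} {β : ℝ → Elem A}, IsWeakSolution Ω I E β →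
      op (β s) = (b : H →L[ℂ] H) → op (α b t) = op (β t) := fun hβ h =>
    congrArg op ((hα _).isWeakSolution.eq_of_eq hτ hΩ hI hU hE hsmooth hβ hs
      ((hαs _).trans (Subtype.ext h.symm)) ht)
  have hop : ∀ b, op (α b s) = (b : H →L[ℂ] H) := fun b => congrArg op (hαs b)
  have hadd : ∀ b c, op (α (b + c) t) = op (α b t) + op (α c t) := fun b c =>
    huniq ((hα b).add hτ hΩ hI hU hE hsmooth (hα c))
      (congrArg₂ (fun x y : H →L[ℂ] H => x + y) (hop b) (hop c))
  have hsmul : ∀ (k : ℂ) b, op (α (k • b) t) = k • op (α b t) := fun k b =>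
    huniq ((hα b).smul hτ hΩ hI hU hE hsmooth k) (congrArg (fun x : H →L[ℂ] H => k • x) (hop b))
  have hmul : ∀ b c, op (α (b * c) t) = op (α b t) * op (α c t) := fun b c =>
    huniq ((hα b).mul hτ hΩ hI hU hE hsmooth (hα c) (hαB b) (hαB c))
      (congrArg₂ (fun x y : H →L[ℂ] H => x * y) (hop b) (hop c))
  have hstar : ∀ b, op (α (star b) t) = star (op (α b t)) := fun b =>
    huniq ((hα b).star hτ hΩ hU hE hsmooth) (congrArg (fun x : H →L[ℂ] H => star x) (hop b))
  let f : Elem (B s) →⋆ₙₐ[ℂ] Elem (B t) :=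
    { toFun := fun b => ⟨op (α b t), hαB b t ht⟩
      map_smul' := fun k b => Subtype.ext (hsmul k b)
      map_zero' := Subtype.ext (by
        have h := hsmul 0 0
        rwa [zero_smul, zero_smul] at h)
      map_add' := fun b c => Subtype.ext (hadd b c)
      map_mul' := fun b c => Subtype.ext (hmul b c)
      map_star' := fun b => Subtype.ext (hstar b) }
  have hf : ∀ b, (f b : H →L[ℂ] H) = op (α b t) := fun b => rfl
  refine ⟨StarAlgEquiv.ofBijective f ⟨fun b c h => ?_, fun y => ?_⟩, fun b => ?_⟩
  · have h1 : α b t = α c t := by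
      apply Subtype.ext
      change op (α b t) = op (α c t)
      rw [← hf, ← hf]
      exact congrArg Subtype.val h
    have h2 := (hα b).isWeakSolution.eq_of_eq hτ hΩ hI hU hE hsmooth (hα c).isWeakSolution ht h1 hs
    exact Subtype.ext ((hop b).symm.trans ((congrArg op h2).trans (hop c)))
  · obtain ⟨β, hβ, hβt⟩ := exists_isStrongSolution hτ hΩ hI hU hE hsmooth ht
      ⟨(y : H →L[ℂ] H), hBA t ht _ y.2⟩
    have hβs : op (β s) ∈ B s := hβ.mem hτ hΩ hI hU hE hsmooth ht (by rw [hβt]; exact y.2) hs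
    refine ⟨⟨op (β s), hβs⟩, Subtype.ext ?_⟩
    rw [hf, huniq hβ.isWeakSolution rfl, hβt]
  · exact congrArg op
      (propagator_eq hτ hΩ hI hU hE hsmooth (hα b).isWeakSolution hs (hαs b) ht)

end Propagator

theorem uniqueDiffOn_of_ordConnected {I : Set ℝ} (hI : I.OrdConnected) (h : I.Nontrivial) :
    UniqueDiffOn ℝ I := by
  obtain ⟨x, hx, y, hy, hxy⟩ := h.exists_lt
  refine uniqueDiffOn_convex hI.convex ?_
  rw [← nonempty_Ioo] at hxy
  exact hxy.mono (interior_maximal (Ioo_subset_Icc_self.trans (hI.out hx hy)) isOpen_Ioo)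

end VNPath

end

theorem mainTheorem2 {H : Type*} [NormedAddCommGroup H] [InnerProductSpace ℂ H]
    [CompleteSpace H] (A : VonNeumannAlgebra H) (τ : VNPath.Elem A →ₗ[ℂ] ℂ) (Ω : H)
    (hτ : VNPath.IsFaithfulNormalTrace A τ) (hΩ : VNPath.IsStandardSpace A τ Ω)
    (I : Set ℝ) (hI : I.OrdConnected) (h0 : (0 : ℝ) ∈ I)
    (B : ℝ → VonNeumannAlgebra H) (hBA : ∀ t ∈ I, ∀ x ∈ B t, x ∈ A)
    (E : ℝ → VNPath.Elem A →ₗ[ℂ] VNPath.Elem A)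
    (hE : ∀ t ∈ I, VNPath.IsTraceCondExp A (B t) τ (E t))
    (hsmooth : VNPath.IsSmoothPath I E)
    (hdE : VNPath.SquareIntegrableDerivative Ω I E) :
    -- well-definedness of `G_t = G_{t,0}`: the curve `t ↦ G_t(a)` is the unique weak solution
    -- of the transport equation on `I` with initial value `a` at time `0`
    (∀ a : VNPath.Elem A,
      VNPath.IsWeakSolution Ω I E (fun t => VNPath.propagator Ω I E t 0 a) ∧
      VNPath.propagator Ω I E 0 0 a = a ∧
      ∀ α : ℝ → VNPath.Elem A, VNPath.IsWeakSolution Ω I E α → α 0 = a →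
        ∀ t ∈ I, α t = VNPath.propagator Ω I E t 0 a) ∧
    -- the restriction of `G_t` to `B_0` is a `*`-isomorphism onto `B_t`
    ∀ t ∈ I, ∃ θ : VNPath.Elem (B 0) ≃⋆ₐ[ℂ] VNPath.Elem (B t),
      ∀ b : VNPath.Elem (B 0),
        (θ b : H →L[ℂ] H) =
          (VNPath.propagator Ω I E t 0 ⟨(b : H →L[ℂ] H), hBA 0 h0 _ b.2⟩ : H →L[ℂ] H) := by
  rcases I.subsingleton_or_nontrivial with hsub | hnt
  · -- on the one-point interval every curve is a weak solution
    obtain rfl : I = {0} := hsub.eq_singleton_of_mem h0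
    have hweak : ∀ α : ℝ → VNPath.Elem A, VNPath.IsWeakSolution Ω {0} E α :=
      fun α ξ t _ => hasDerivWithinAt_iff_hasFDerivWithinAt.2
        (.of_subsingleton subsingleton_singleton)
    have hprop : ∀ a : VNPath.Elem A, VNPath.propagator Ω {0} E 0 0 a = a := fun a =>
      (VNPath.propagator_spec (hweak fun _ => a) rfl).2
    refine ⟨fun a => ⟨hweak _, hprop a, fun α _ hα t ht => ?_⟩, fun t ht => ?_⟩
    · rw [mem_singleton_iff.1 ht, hprop, hα]
    · obtain rfl := mem_singleton_iff.1 ht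
      exact ⟨StarAlgEquiv.refl _ _, fun b => by rw [hprop]; rfl⟩
  · have hU := VNPath.uniqueDiffOn_of_ordConnected hI hnt
    refine ⟨fun a => ?_, fun t ht =>
      VNPath.exists_starAlgEquiv hτ hΩ hI hU hBA hE hsmooth h0 ht⟩
    obtain ⟨α, hα, hα0⟩ := VNPath.exists_isStrongSolution hτ hΩ hI hU hE hsmooth h0 a
    obtain ⟨h1, h2⟩ := VNPath.propagator_spec hα.isWeakSolution hα0
    exact ⟨h1, h2, fun β hβ hβ0 t ht =>
      VNPath.propagator_eq hτ hΩ hI hU hE hsmooth hβ h0 hβ0 ht⟩
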